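/- Consider two rigid bodies $X\in\{B,T\}$ (a UAV and a target) with $Q_X(t)\in SO(3)$, $p_X(t),v_X(t)\in\mathbb R^3$ and, for all $t\ge 0$, $\dot Q_X=Q_X\omega_X^\times$, $\dot p_X=v_X$, $\dot v_X=Q_Xa_X+g e_3$, where $\omega^\times$ is the matrix of $x\mapsto\omega\times x$, $\omega_X(t), a_X(t)\in\mathbb R^3$, $g\in\mathbb R$ is a constant and $e_3=(0,0,1)^\top$. Let $\xi=Q_B^\top(p_B-p_T)$, assume $\xi(t)\ne0$ for all $t\ge 0$, and put $y_\xi=\xi/|\xi|$, $y_\xi^{\mathcal I}=Q_By_\xi$ and $\pi_u=I_3-uu^\top$. Let $$A(t)=\begin{bmatrix}-\omega_B^\times& I_3\\ 0&-\omega_B^\times\end{bmatrix},\qquad C(t)=\begin{bmatrix}\pi_{y_\xi}&0_{3,3}\end{bmatrix}.$$ Assume that $\omega_B$ and $\omega_T$ are bounded and uniformly continuous on $[0,\infty)$, and that there exist $\delta,\mu>0$ such that for all $t\ge0$ $$\frac1\delta\int_t^{t+\delta}\pi_{y_\xi^{\mathcal I}(s)}\,ds\succeq\mu I_3 .$$ Then: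 (i) The pair $(A(t),C(t))$ is uniformly observable: there exist $\bar\delta,\bar\mu>0$ such that for all $t\ge0$ $$\frac1{\bar\delta}\int_t^{t+\bar\delta}\Phi(s,t)^\top C(s)^\top C(s)\Phi(s,t)\,ds\succeq\bar\mu I_6,$$ where $\Phi$ is the state transition matrix of $A$: $\partial_s\Phi(s,t)=A(s)\Phi(s,t)$, $\Phi(t,t)=I_6$. (ii) Let $S(t)\in\mathbb R^{6\times6}$ and $D(t)\in\mathbb R^{3\times3}$ be continuous, bounded, symmetric and uniformly positive definite on $[0,\infty)$ (i.e. $aI\preceq S(t)\preceq bI$ for some constants $0<a\le b$ and all $t\ge 0$, and similarly for $D$), and let $P_0\in\mathbb R^{6\times6}$ be symmetric positive definite. Then the Riccati equation $\dot P=AP+PA^\top-PC^\top DCP+S$, $P(0)=P_0$, has a unique solution on $[0,\infty)$, and with the gain $K=PC^\top D$ the equilibrium $x=0$ of the unforced error system $\dot x=(A(t)-K(t)C(t))x$ is globally exponentially stable: there are $c,\lambda>0$ such that for every $t_0\ge 0$ a solution on $[t_0,\infty)$ exists for each initial state $x(t_0)\in\mathbb R^6$, and every solution satisfies $|x(t)|\le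 c\,e^{-\lambda(t-t_0)}|x(t_0)|$ for all $t\ge t_0$. -/

import Mathlib

open Set Matrix

noncomputable section

/-- Euclidean norm of a real vector. -/
def euclNorm {n : Type*} [Fintype n] (x : n → ℝ) : ℝ := ‖WithLp.toLp 2 x‖

/-- The matrix `ω^×` of the cross product `x ↦ ω × x`. -/
def skew (ω : Fin 3 → ℝ) : Matrix (Fin 3) (Fin 3) ℝ :=
  !![0, -ω 2, ω 1; ω 2, 0, -ω 0; -ω 1, ω 0, 0]

/-- The matrix `π_u = I - u uᵀ`. -/
def proj (u : Fin 3 → ℝ) : Matrix (Fin 3) (Fin 3) ℝ := 1 - vecMulVec u u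

/-- The entrywise integral of a matrix-valued function over `[a, b]`. -/
def matIntegral {m n : Type*} (M : ℝ → Matrix m n ℝ) (a b : ℝ) : Matrix m n ℝ :=
  Matrix.of fun i j => ∫ s in a..b, M s i j

/-- The matrix-valued function `M` has, entrywise, derivative `M'` at `t` within `s`. -/
def MatHasDerivWithinAt {m n : Type*} (M : ℝ → Matrix m n ℝ) (M' : Matrix m n ℝ)
    (s : Set ℝ) (t : ℝ) : Prop :=
  ∀ i j, HasDerivWithinAt (fun τ => M τ i j) (M' i j) s t

/-- `M ⪰ c I` in the Loewner order (in particular, `M` is symmetric). -/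
def LoewnerGE {n : Type*} [DecidableEq n] (M : Matrix n n ℝ) (c : ℝ) : Prop :=
  (M - c • (1 : Matrix n n ℝ)).PosSemidef

/-! ### Linear time-varying systems on `[0, ∞)` -/

/-- `Φ s t` is the state transition matrix from time `t` to time `s` of `ẋ = A x`. -/
def IsTransitionMatrix {n : Type*} [Fintype n] [DecidableEq n]
    (A : ℝ → Matrix n n ℝ) (Φ : ℝ → ℝ → Matrix n n ℝ) : Prop :=
  ∀ t, 0 ≤ t → Φ t t = 1 ∧
    ∀ s, 0 ≤ s → MatHasDerivWithinAt (fun τ => Φ τ t) (A s * Φ s t) (Ici 0) s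

/-- The observability Gramian `W(t, t + δ)`. -/
def gramian {m n : Type*} [Fintype m] [Fintype n]
    (Φ : ℝ → ℝ → Matrix n n ℝ) (C : ℝ → Matrix m n ℝ) (t δ : ℝ) : Matrix n n ℝ :=
  (1 / δ) • matIntegral (fun s => (Φ s t)ᵀ * (C s)ᵀ * C s * Φ s t) t (t + δ)

/-- Uniform observability of the pair `(A, C)`. -/
def UniformlyObservable {m n : Type*} [Fintype m] [Fintype n] [DecidableEq n]
    (A : ℝ → Matrix n n ℝ) (C : ℝ → Matrix m n ℝ) : Prop :=
  ∃ Φ, IsTransitionMatrix A Φ ∧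
    ∃ δ μ : ℝ, 0 < δ ∧ 0 < μ ∧ ∀ t, 0 ≤ t → LoewnerGE (gramian Φ C t δ) μ

/-- `x` solves `ẋ = F(t) x` on `[t₀, ∞)`. -/
def IsLinearSolution {n : Type*} [Fintype n] (F : ℝ → Matrix n n ℝ) (t₀ : ℝ)
    (x : ℝ → n → ℝ) : Prop :=
  ∀ t, t₀ ≤ t → HasDerivWithinAt x (F t *ᵥ x t) (Ici t₀) t

/-- The origin of `ẋ = F(t) x` is (uniformly) globally exponentially stable: from every initial
time and state a solution exists, and all solutions obey one exponential bound. -/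
def GloballyExponentiallyStable {n : Type*} [Fintype n] (F : ℝ → Matrix n n ℝ) : Prop :=
  ∃ c l : ℝ, 0 < c ∧ 0 < l ∧ ∀ t₀, 0 ≤ t₀ → ∀ x₀ : n → ℝ,
    (∃ x, IsLinearSolution F t₀ x ∧ x t₀ = x₀) ∧
    ∀ x, IsLinearSolution F t₀ x → x t₀ = x₀ →
      ∀ t, t₀ ≤ t → euclNorm (x t) ≤ c * Real.exp (-l * (t - t₀)) * euclNorm x₀

/-- A continuous, bounded, uniformly positive definite symmetric matrix-valued function on
`[0, ∞)`. -/
def IsWeight {n : Type*} [DecidableEq n] (S : ℝ → Matrix n n ℝ) : Prop :=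
  ContinuousOn S (Ici 0) ∧
    ∃ a b : ℝ, 0 < a ∧ ∀ t, 0 ≤ t →
      LoewnerGE (S t) a ∧ (b • (1 : Matrix n n ℝ) - S t).PosSemidef

/-- `P` solves `Ṗ = A P + P Aᵀ - P Cᵀ D C P + S` on `[0, ∞)`. -/
def IsRiccatiSolution {m n : Type*} [Fintype m] [Fintype n]
    (A : ℝ → Matrix n n ℝ) (C : ℝ → Matrix m n ℝ) (D : ℝ → Matrix m m ℝ)
    (S : ℝ → Matrix n n ℝ) (P : ℝ → Matrix n n ℝ) : Prop :=
  ∀ t, 0 ≤ t → MatHasDerivWithinAt P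
    (A t * P t + P t * (A t)ᵀ - P t * (C t)ᵀ * D t * C t * P t + S t) (Ici 0) t

/-- The gain `K = P Cᵀ D`. -/
def riccatiGain {m n : Type*} [Fintype m] [Fintype n]
    (C : ℝ → Matrix m n ℝ) (D : ℝ → Matrix m m ℝ) (P : ℝ → Matrix n n ℝ) (t : ℝ) :
    Matrix n m ℝ :=
  P t * (C t)ᵀ * D t

/-! ### The two vehicles and the position/velocity error system -/

/-- A rigid motion on `[0, ∞)` under gravity `g e₃`: attitude `Q`, inertial position `p` and
velocity `v`, body-frame angular velocity `ω` and specific acceleration `a`. -/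
structure RigidMotion (g : ℝ) where
  Q : ℝ → Matrix (Fin 3) (Fin 3) ℝ
  p : ℝ → Fin 3 → ℝ
  v : ℝ → Fin 3 → ℝ
  ω : ℝ → Fin 3 → ℝ
  a : ℝ → Fin 3 → ℝ
  Q_mem : ∀ t, 0 ≤ t → Q t ∈ Matrix.specialOrthogonalGroup (Fin 3) ℝ
  Q_deriv : ∀ t, 0 ≤ t → MatHasDerivWithinAt Q (Q t * skew (ω t)) (Ici 0) t
  p_deriv : ∀ t, 0 ≤ t → HasDerivWithinAt p (v t) (Ici 0) t
  v_deriv : ∀ t, 0 ≤ t → HasDerivWithinAt v (Q t *ᵥ a t + g • ![0, 0, 1]) (Ici 0) t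

/-- The relative position `ξ = Q_Bᵀ (p_B - p_T)`. -/
def relPos {g : ℝ} (B T : RigidMotion g) (t : ℝ) : Fin 3 → ℝ :=
  (B.Q t)ᵀ *ᵥ (B.p t - T.p t)

/-- The bearing `y_ξ = ξ / |ξ|`. -/
def bearing {g : ℝ} (B T : RigidMotion g) (t : ℝ) : Fin 3 → ℝ :=
  (euclNorm (relPos B T t))⁻¹ • relPos B T t

/-- The bearing in the inertial frame, `Q_B y_ξ`. -/
def inertialBearing {g : ℝ} (B T : RigidMotion g) (t : ℝ) : Fin 3 → ℝ :=
  B.Q t *ᵥ bearing B T t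

/-- Persistence of excitation of a direction `y`. -/
def PersistentlyExciting (y : ℝ → Fin 3 → ℝ) : Prop :=
  ∃ δ μ : ℝ, 0 < δ ∧ 0 < μ ∧ ∀ t, 0 ≤ t →
    LoewnerGE ((1 / δ) • matIntegral (fun s => proj (y s)) t (t + δ)) μ

/-- The state matrix `A(t)` of the error system. -/
def errorA {g : ℝ} (B : RigidMotion g) (t : ℝ) : Matrix (Fin 3 ⊕ Fin 3) (Fin 3 ⊕ Fin 3) ℝ :=
  Matrix.fromBlocks (-skew (B.ω t)) 1 0 (-skew (B.ω t))

/-- The output matrix `C(t)` of the error system. -/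
def errorC {g : ℝ} (B T : RigidMotion g) (t : ℝ) : Matrix (Fin 3) (Fin 3 ⊕ Fin 3) ℝ :=
  Matrix.fromCols (proj (bearing B T t)) 0

end

/-!
The rotation of both halves of the state by `Q_B` is an orthogonal change of coordinates taking the
error system to the double integrator `p̈ = 0`, observed through `π_y Q_Bᵀ p`, whose squared norm is
`pᵀ π_{y^I} p`. Persistence of excitation therefore makes the position visible on every window, and
two windows far apart reveal the velocity: the pair is uniformly observable. For a bounded pair
this suffices to build the Riccati observer. The solution is `P = X Y⁻¹` for the associated
Hamiltonian system; it is bounded above because `wᵀ P w` is at most the cost of steering the adjoint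
system from `0` to `w`, and below because `S` is; and `xᵀ P⁻¹ x` is then a quadratic Lyapunov
function decaying at an exponential rate.
-/

/-! ### Matrix calculus -/

section MatrixCalculus

variable {l m n : Type*} {s : Set ℝ} {t : ℝ}

lemma MatHasDerivWithinAt.mono {M : ℝ → Matrix m n ℝ} {M' : Matrix m n ℝ} {u : Set ℝ}
    (h : MatHasDerivWithinAt M M' s t) (hu : u ⊆ s) : MatHasDerivWithinAt M M' u t :=
  fun i j => (h i j).mono hu

lemma MatHasDerivWithinAt.congr {M N : ℝ → Matrix m n ℝ} {M' : Matrix m n ℝ}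
    (h : MatHasDerivWithinAt M M' s t) (hN : EqOn N M s) (ht : t ∈ s) :
    MatHasDerivWithinAt N M' s t :=
  fun i j => (h i j).congr (fun r hr => by rw [hN hr]) (by rw [hN ht])

lemma MatHasDerivWithinAt.const (M : Matrix m n ℝ) : MatHasDerivWithinAt (fun _ => M) 0 s t :=
  fun i j => hasDerivWithinAt_const t s (M i j)

lemma MatHasDerivWithinAt.sub {M N : ℝ → Matrix m n ℝ} {M' N' : Matrix m n ℝ}
    (hM : MatHasDerivWithinAt M M' s t) (hN : MatHasDerivWithinAt N N' s t) :
    MatHasDerivWithinAt (fun r => M r - N r) (M' - N') s t :=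
  fun i j => (hM i j).sub (hN i j)

lemma MatHasDerivWithinAt.transpose {M : ℝ → Matrix m n ℝ} {M' : Matrix m n ℝ}
    (hM : MatHasDerivWithinAt M M' s t) : MatHasDerivWithinAt (fun r => (M r)ᵀ) M'ᵀ s t :=
  fun i j => hM j i

lemma MatHasDerivWithinAt.mul [Fintype m] {M : ℝ → Matrix l m ℝ} {N : ℝ → Matrix m n ℝ}
    {M' : Matrix l m ℝ} {N' : Matrix m n ℝ}
    (hM : MatHasDerivWithinAt M M' s t) (hN : MatHasDerivWithinAt N N' s t) :
    MatHasDerivWithinAt (fun r => M r * N r) (M' * N t + M t * N') s t := by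
  intro i j
  simp only [Matrix.mul_apply, Matrix.add_apply, ← Finset.sum_add_distrib]
  exact HasDerivWithinAt.fun_sum fun k _ => (hM i k).mul (hN k j)

lemma hasDerivWithinAt_dotProduct [Fintype n] {x y : ℝ → n → ℝ} {x' y' : n → ℝ}
    (hx : HasDerivWithinAt x x' s t) (hy : HasDerivWithinAt y y' s t) :
    HasDerivWithinAt (fun r => x r ⬝ᵥ y r) (x' ⬝ᵥ y t + x t ⬝ᵥ y') s t := by
  rw [hasDerivWithinAt_pi] at hx hy
  simp only [dotProduct, ← Finset.sum_add_distrib]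
  exact HasDerivWithinAt.fun_sum fun k _ => (hx k).mul (hy k)

lemma MatHasDerivWithinAt.mulVec [Finite m] [Fintype n] {M : ℝ → Matrix m n ℝ} {x : ℝ → n → ℝ}
    {M' : Matrix m n ℝ} {x' : n → ℝ}
    (hM : MatHasDerivWithinAt M M' s t) (hx : HasDerivWithinAt x x' s t) :
    HasDerivWithinAt (fun r => M r *ᵥ x r) (M' *ᵥ x t + M t *ᵥ x') s t :=
  have := Fintype.ofFinite m
  hasDerivWithinAt_pi.2 fun i =>
    hasDerivWithinAt_dotProduct (hasDerivWithinAt_pi.2 (hM i)) hx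

lemma MatHasDerivWithinAt.continuousOn {M M' : ℝ → Matrix m n ℝ}
    (h : ∀ t ∈ s, MatHasDerivWithinAt M (M' t) s t) : ContinuousOn M s :=
  continuousOn_pi.2 fun i => continuousOn_pi.2 fun j t ht => (h t ht i j).continuousWithinAt

lemma matHasDerivWithinAt_iff [Finite n] {M : ℝ → Matrix m n ℝ}
    {M' : Matrix m n ℝ} : MatHasDerivWithinAt M M' s t ↔ HasDerivWithinAt M M' s t := by
  have := Fintype.ofFinite n
  refine Iff.symm ((hasDerivWithinAt_pi (φ := M) (φ' := M')).trans ?_)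
  exact forall_congr' fun i => hasDerivWithinAt_pi

open scoped Matrix.Norms.Operator in
lemma MatHasDerivWithinAt.inv [Fintype n] [DecidableEq n] {M : ℝ → Matrix n n ℝ}
    {M' : Matrix n n ℝ} (hM : MatHasDerivWithinAt M M' s t) (hunit : IsUnit (M t)) :
    MatHasDerivWithinAt (fun r => (M r)⁻¹) (-((M t)⁻¹ * M' * (M t)⁻¹)) s t := by
  rw [matHasDerivWithinAt_iff] at hM ⊢
  obtain ⟨u, hu⟩ := hunit
  have hinv := hasFDerivAt_ringInverse (𝕜 := ℝ) u
  rw [hu] at hinv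
  have h := hinv.comp_hasDerivWithinAt t hM
  simp only [Function.comp_def, ← nonsing_inv_eq_ringInverse, _root_.neg_apply,
    ContinuousLinearMap.mulLeftRight_apply, coe_units_inv, hu] at h
  exact h

lemma continuousOn_matrix_mul [Fintype m] {M : ℝ → Matrix l m ℝ} {N : ℝ → Matrix m n ℝ}
    (hM : ContinuousOn M s) (hN : ContinuousOn N s) : ContinuousOn (fun r => M r * N r) s := by
  rw [continuousOn_iff_continuous_domRestrict] at *
  exact Continuous.matrix_mul hM hN

lemma continuousOn_matrix_transpose {M : ℝ → Matrix m n ℝ} (hM : ContinuousOn M s) :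
    ContinuousOn (fun r => (M r)ᵀ) s := by
  rw [continuousOn_iff_continuous_domRestrict] at *
  exact Continuous.matrix_transpose hM

lemma continuousOn_transpose_mul_mul [Fintype m] {C : ℝ → Matrix m n ℝ} {D : ℝ → Matrix m m ℝ}
    (hC : ContinuousOn C s) (hD : ContinuousOn D s) :
    ContinuousOn (fun r => (C r)ᵀ * D r * C r) s :=
  continuousOn_matrix_mul (continuousOn_matrix_mul (continuousOn_matrix_transpose hC) hD) hC

lemma continuousOn_matrix_mulVec [Fintype n] {M : ℝ → Matrix m n ℝ} {x : ℝ → n → ℝ}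
    (hM : ContinuousOn M s) (hx : ContinuousOn x s) : ContinuousOn (fun r => M r *ᵥ x r) s := by
  rw [continuousOn_iff_continuous_domRestrict] at *
  exact Continuous.matrix_mulVec hM hx

lemma matIntegral_eq_sub_of_hasDerivWithinAt {F F' : ℝ → Matrix m n ℝ} {a b : ℝ} (hab : a ≤ b)
    (hF : ∀ t ∈ Icc a b, MatHasDerivWithinAt F (F' t) (Icc a b) t)
    (hF' : ContinuousOn F' (Icc a b)) : matIntegral F' a b = F b - F a := by
  ext i j
  exact intervalIntegral.integral_eq_sub_of_hasDeriv_right_of_le hab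
    (fun t ht => (hF t ht i j).continuousWithinAt)
    (fun t ht => (hF t (Ioo_subset_Icc_self ht) i j).mono_of_mem_nhdsWithin
      (mem_nhdsWithin_of_mem_nhds (Icc_mem_nhds ht.1 ht.2)))
    ((continuousOn_pi.1 (continuousOn_pi.1 hF' i) j).intervalIntegrable_of_Icc hab)

end MatrixCalculus

section Comparison

variable {a b : ℝ}

lemma le_of_hasDerivWithinAt_nonneg {f f' : ℝ → ℝ} (hab : a ≤ b)
    (hf : ∀ t ∈ Icc a b, HasDerivWithinAt f (f' t) (Icc a b) t)
    (hf' : ∀ t ∈ Icc a b, 0 ≤ f' t) : f a ≤ f b := by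
  have hmono : MonotoneOn f (Icc a b) :=
    monotoneOn_of_hasDerivWithinAt_nonneg (convex_Icc a b)
      (fun t ht => (hf t ht).continuousWithinAt)
      (fun t ht => (hf t (interior_subset ht)).mono interior_subset)
      (fun t ht => hf' t (interior_subset ht))
  exact hmono (left_mem_Icc.2 hab) (right_mem_Icc.2 hab) hab

lemma norm_le_norm_mul_exp {E : Type*} [NormedAddCommGroup E] [NormedSpace ℝ E]
    {f f' : ℝ → E} {K : ℝ} (hf : ∀ t ∈ Icc a b, HasDerivWithinAt f (f' t) (Icc a b) t)
    (hf' : ∀ t ∈ Icc a b, ‖f' t‖ ≤ K * ‖f t‖) {t : ℝ} (ht : t ∈ Icc a b) :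
    ‖f t‖ ≤ ‖f a‖ * Real.exp (K * (t - a)) := by
  rw [← gronwallBound_ε0]
  refine norm_le_gronwallBound_of_norm_deriv_right_le (f' := f') (b := b)
    (fun t ht => (hf t ht).continuousWithinAt) (fun t ht => ?_) le_rfl (fun t ht => ?_) t ht
  · exact (hf t (Ico_subset_Icc_self ht)).mono_of_mem_nhdsWithin (Icc_mem_nhdsGE_of_mem ht)
  · simpa using hf' t (Ico_subset_Icc_self ht)

end Comparison

/-! ### Linear differential equations -/

section LinearODE

variable {n : Type*} [Fintype n]

/-- `x` solves `ẋ = F(t) x` on the set of times `s`, with one-sided derivatives at its ends. -/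
def IsLinearSolutionOn (F : ℝ → Matrix n n ℝ) (s : Set ℝ) (x : ℝ → n → ℝ) : Prop :=
  ∀ t ∈ s, HasDerivWithinAt x (F t *ᵥ x t) s t

lemma IsLinearSolutionOn.mono {F : ℝ → Matrix n n ℝ} {s u : Set ℝ} {x : ℝ → n → ℝ}
    (hx : IsLinearSolutionOn F s x) (hu : u ⊆ s) : IsLinearSolutionOn F u x :=
  fun t ht => (hx t (hu ht)).mono hu

lemma IsLinearSolutionOn.sub {F : ℝ → Matrix n n ℝ} {s : Set ℝ} {x y : ℝ → n → ℝ}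
    (hx : IsLinearSolutionOn F s x) (hy : IsLinearSolutionOn F s y) :
    IsLinearSolutionOn F s (fun t => x t - y t) := fun t ht => by
  rw [mulVec_sub]
  exact (hx t ht).sub (hy t ht)

/-- Coordinatewise truncation of a vector to `[-R, R]`: replacing `F x` by `F (clip R x)` makes a
linear vector field bounded, so that Picard–Lindelöf applies on intervals of any length. -/
def clip (R : ℝ) (x : n → ℝ) : n → ℝ := fun i => max (-R) (min R (x i))

lemma norm_clip_sub_clip_le (R : ℝ) (x y : n → ℝ) : ‖clip R x - clip R y‖ ≤ ‖x - y‖ := by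
  refine (pi_norm_le_iff_of_nonneg (norm_nonneg _)).2 fun i => ?_
  calc |max (-R) (min R (x i)) - max (-R) (min R (y i))|
      ≤ |min R (x i) - min R (y i)| := by
        simpa using abs_max_sub_max_le_max (-R) (min R (x i)) (-R) (min R (y i))
    _ ≤ |x i - y i| := by simpa using abs_min_sub_min_le_max R (x i) R (y i)
    _ ≤ ‖x - y‖ := norm_le_pi_norm (x - y) i

lemma norm_clip_le {R : ℝ} (hR : 0 ≤ R) (x : n → ℝ) : ‖clip R x‖ ≤ R :=
  (pi_norm_le_iff_of_nonneg hR).2 fun _ =>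
    abs_le.2 ⟨le_max_left _ _, max_le (by linarith) (min_le_left _ _)⟩

lemma norm_clip_le_norm {R : ℝ} (hR : 0 ≤ R) (x : n → ℝ) : ‖clip R x‖ ≤ ‖x‖ := by
  have hzero : clip R (0 : n → ℝ) = 0 := funext fun i => by simp [clip, hR]
  simpa [hzero] using norm_clip_sub_clip_le R x 0

lemma clip_eq_self {R : ℝ} {x : n → ℝ} (hx : ‖x‖ ≤ R) : clip R x = x := by
  ext i
  have h := abs_le.1 ((norm_le_pi_norm x i).trans hx)
  rw [clip, min_eq_right h.2, max_eq_right h.1]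

open scoped Matrix.Norms.Operator

variable {F : ℝ → Matrix n n ℝ} {a b : ℝ}

lemma exists_norm_mulVec_le (hF : ContinuousOn F (Icc a b)) :
    ∃ K, 0 ≤ K ∧ ∀ t ∈ Icc a b, ∀ x : n → ℝ, ‖F t *ᵥ x‖ ≤ K * ‖x‖ := by
  obtain ⟨K, hK⟩ := isCompact_Icc.exists_bound_of_continuousOn hF
  refine ⟨max K 0, le_max_right _ _, fun t ht x => (linfty_opNorm_mulVec _ _).trans ?_⟩
  exact mul_le_mul_of_nonneg_right ((hK t ht).trans (le_max_left _ _)) (norm_nonneg x)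

lemma exists_hasDerivWithinAt_mulVec_clip (hab : a ≤ b) (hF : ContinuousOn F (Icc a b))
    {R : ℝ} (hR : 0 ≤ R) (x₀ : n → ℝ) :
    ∃ x : ℝ → n → ℝ, x a = x₀ ∧
      ∀ t ∈ Icc a b, HasDerivWithinAt x (F t *ᵥ clip R (x t)) (Icc a b) t := by
  obtain ⟨K, hK0, hK⟩ := exists_norm_mulVec_le hF
  have hba : 0 ≤ b - a := sub_nonneg.2 hab
  have hPL : IsPicardLindelof (fun t x => F t *ᵥ clip R x) (⟨a, left_mem_Icc.2 hab⟩ : Icc a b) x₀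
      (K * R * (b - a)).toNNReal 0 (K * R).toNNReal K.toNNReal := by
    refine ⟨fun t ht => LipschitzOnWith.of_dist_le_mul fun x _ y _ => ?_,
      fun x _ => continuousOn_matrix_mulVec hF continuousOn_const, fun t ht x _ => ?_, ?_⟩
    · rw [dist_eq_norm, dist_eq_norm, ← mulVec_sub, Real.coe_toNNReal _ hK0]
      exact (hK t ht _).trans (mul_le_mul_of_nonneg_left (norm_clip_sub_clip_le R x y) hK0)
    · rw [Real.coe_toNNReal _ (by positivity)]
      exact (hK t ht _).trans (mul_le_mul_of_nonneg_left (norm_clip_le hR x) hK0)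
    · simp [hba, mul_nonneg, hK0, hR]
  exact hPL.exists_eq_forall_mem_Icc_hasDerivWithinAt₀

lemma exists_isLinearSolutionOn_Icc (hab : a ≤ b) (hF : ContinuousOn F (Icc a b)) (x₀ : n → ℝ) :
    ∃ x, IsLinearSolutionOn F (Icc a b) x ∧ x a = x₀ := by
  obtain ⟨K, hK0, hK⟩ := exists_norm_mulVec_le hF
  set R : ℝ := ‖x₀‖ * Real.exp (K * (b - a))
  have hR : 0 ≤ R := by positivity
  obtain ⟨x, hxa, hx⟩ := exists_hasDerivWithinAt_mulVec_clip hab hF hR x₀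
  have hbound : ∀ t ∈ Icc a b, ‖x t‖ ≤ R := fun t ht =>
    calc ‖x t‖ ≤ ‖x a‖ * Real.exp (K * (t - a)) :=
          norm_le_norm_mul_exp hx (fun t ht => (hK t ht _).trans
            (mul_le_mul_of_nonneg_left (norm_clip_le_norm hR _) hK0)) ht
      _ ≤ R := by
          simp only [hxa, R]
          gcongr
          exact ht.2
  refine ⟨x, fun t ht => ?_, hxa⟩
  simpa only [clip_eq_self (hbound t ht)] using hx t ht

lemma IsLinearSolutionOn.eq_zero (hF : ContinuousOn F (Icc a b)) {x : ℝ → n → ℝ}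
    (hx : IsLinearSolutionOn F (Icc a b) x) (hxa : x a = 0) {t : ℝ} (ht : t ∈ Icc a b) :
    x t = 0 := by
  obtain ⟨K, -, hK⟩ := exists_norm_mulVec_le hF
  simpa [hxa] using norm_le_norm_mul_exp hx (fun t ht => hK t ht _) ht

lemma IsLinearSolutionOn.eqOn (hF : ContinuousOn F (Icc a b)) {x y : ℝ → n → ℝ}
    (hx : IsLinearSolutionOn F (Icc a b) x) (hy : IsLinearSolutionOn F (Icc a b) y)
    (hxy : x a = y a) : EqOn x y (Icc a b) :=
  fun _ ht => sub_eq_zero.1 ((hx.sub hy).eq_zero hF (sub_eq_zero.2 hxy) ht)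

lemma exists_isLinearSolutionOn_Icc_of_terminal (hab : a ≤ b) (hF : ContinuousOn F (Icc a b))
    (w : n → ℝ) : ∃ z, IsLinearSolutionOn F (Icc a b) z ∧ z b = w := by
  have hrefl : MapsTo (fun t => a + b - t) (Icc a b) (Icc a b) := fun t ht =>
    ⟨by linarith [ht.2], by linarith [ht.1]⟩
  obtain ⟨y, hy, hya⟩ := exists_isLinearSolutionOn_Icc (F := fun t => -F (a + b - t)) hab
    (hF.comp (by fun_prop) hrefl).neg w
  refine ⟨fun t => y (a + b - t), fun t ht => ?_, by simpa using hya⟩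
  have hderiv : HasDerivWithinAt (fun t => a + b - t) (-1) (Icc a b) t := by
    simpa using (hasDerivWithinAt_id t (Icc a b)).const_sub (a + b)
  simpa [neg_mulVec, Function.comp_def] using (hy _ (hrefl ht)).scomp t hderiv hrefl

theorem exists_isLinearSolution (hF : ContinuousOn F (Ici a)) (x₀ : n → ℝ) :
    ∃ x, IsLinearSolution F a x ∧ x a = x₀ := by
  have hFN (N : ℕ) : ContinuousOn F (Icc a (a + N)) := hF.mono Icc_subset_Ici_self
  choose x hx hxa using fun N : ℕ =>
    exists_isLinearSolutionOn_Icc (le_add_of_nonneg_right N.cast_nonneg) (hFN N) x₀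
  have hcons : ∀ N M : ℕ, N ≤ M → EqOn (x M) (x N) (Icc a (a + N)) := fun N M hNM =>
    ((hx M).mono (Icc_subset_Icc_right (by gcongr))).eqOn (hFN N) (hx N)
      ((hxa M).trans (hxa N).symm)
  have hceil (t : ℝ) : t ≤ a + ⌈t - a⌉₊ := by linarith [Nat.le_ceil (t - a)]
  have hglue (N : ℕ) : EqOn (fun t => x ⌈t - a⌉₊ t) (x N) (Icc a (a + N)) := fun t ht => by
    rcases le_total N ⌈t - a⌉₊ with h | h
    · exact hcons _ _ h ht
    · exact (hcons _ _ h ⟨ht.1, hceil t⟩).symm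
  refine ⟨fun t => x ⌈t - a⌉₊ t, fun t ht => ?_, (hglue 0 (by simp)).trans (hxa 0)⟩
  obtain ⟨N, hN⟩ := exists_nat_gt (t - a)
  have htN : t ∈ Icc a (a + N) := ⟨ht, by linarith⟩
  have hnhds : Icc a (a + N) ∈ nhdsWithin t (Ici a) := by
    rw [← Ici_inter_Iic]
    exact inter_mem_nhdsWithin _ (Iic_mem_nhds (by linarith))
  have h := ((hx N t htN).congr (hglue N) (hglue N htN)).mono_of_mem_nhdsWithin hnhds
  rwa [← hglue N htN] at h

end LinearODE

/-! ### Quadratic forms -/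

section LoewnerBounds

variable {n : Type*} [DecidableEq n] {M : Matrix n n ℝ} {b c : ℝ}

/-- `M ⪯ c I` in the Loewner order (in particular, `M` is symmetric): the upper counterpart of
`LoewnerGE`. -/
def LoewnerLE (M : Matrix n n ℝ) (c : ℝ) : Prop :=
  (c • (1 : Matrix n n ℝ) - M).PosSemidef

lemma LoewnerGE.transpose_eq (h : LoewnerGE M c) : Mᵀ = M := by
  simpa [IsHermitian] using h.isHermitian

lemma LoewnerGE.mono (h : LoewnerGE M c) (hb : b ≤ c) : LoewnerGE M b := by
  simpa [LoewnerGE, sub_smul] using PosSemidef.add h (PosSemidef.one.smul (sub_nonneg.2 hb))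

lemma LoewnerLE.mono (h : LoewnerLE M c) (hb : c ≤ b) : LoewnerLE M b := by
  simpa [LoewnerLE, sub_smul] using PosSemidef.add h (PosSemidef.one.smul (sub_nonneg.2 hb))

lemma LoewnerGE.posSemidef (h : LoewnerGE M c) (hc : 0 ≤ c) : M.PosSemidef := by
  simpa [LoewnerGE] using h.mono hc

lemma IsWeight.exists_bounds {S : ℝ → Matrix n n ℝ} (hS : IsWeight S) :
    ∃ a b : ℝ, 0 < a ∧ 0 < b ∧ ∀ t, 0 ≤ t → LoewnerGE (S t) a ∧ LoewnerLE (S t) b := by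
  obtain ⟨-, a, b, ha, h⟩ := hS
  exact ⟨a, max b 1, ha, by positivity, fun t ht =>
    ⟨(h t ht).1, LoewnerLE.mono (h t ht).2 (le_max_left b 1)⟩⟩

lemma IsWeight.transpose_eq {S : ℝ → Matrix n n ℝ} (hS : IsWeight S) {t : ℝ} (ht : 0 ≤ t) :
    (S t)ᵀ = S t := by
  obtain ⟨a, b, -, -, h⟩ := hS.exists_bounds
  exact (h t ht).1.transpose_eq

lemma IsWeight.posSemidef {S : ℝ → Matrix n n ℝ} (hS : IsWeight S) {t : ℝ} (ht : 0 ≤ t) :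
    (S t).PosSemidef := by
  obtain ⟨a, b, ha, -, h⟩ := hS.exists_bounds
  exact (h t ht).1.posSemidef ha.le

end LoewnerBounds

section QuadraticForms

variable {n : Type*} [Fintype n]

lemma dotProduct_self_nonneg_real (x : n → ℝ) : 0 ≤ x ⬝ᵥ x := by
  simpa using dotProduct_star_self_nonneg x

lemma euclNorm_eq_sqrt (x : n → ℝ) : euclNorm x = √(x ⬝ᵥ x) := by
  rw [euclNorm, EuclideanSpace.norm_eq]
  exact congrArg Real.sqrt (Finset.sum_congr rfl fun i _ => by simp [sq])

lemma dotProduct_self_eq_euclNorm_sq (x : n → ℝ) : x ⬝ᵥ x = euclNorm x ^ 2 := by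
  rw [euclNorm_eq_sqrt, Real.sq_sqrt (dotProduct_self_nonneg_real x)]

lemma two_mul_dotProduct_le {c : ℝ} (hc : 0 < c) (x y : n → ℝ) :
    2 * (x ⬝ᵥ y) ≤ c * (x ⬝ᵥ x) + c⁻¹ * (y ⬝ᵥ y) := by
  have hsq : 0 ≤ c⁻¹ * ((c • x - y) ⬝ᵥ (c • x - y)) :=
    mul_nonneg (inv_nonneg.2 hc.le) (dotProduct_self_nonneg_real _)
  have hexpand : c⁻¹ * ((c • x - y) ⬝ᵥ (c • x - y)) =
      c * (x ⬝ᵥ x) + c⁻¹ * (y ⬝ᵥ y) - 2 * (x ⬝ᵥ y) := by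
    simp only [sub_dotProduct, dotProduct_sub, smul_dotProduct, dotProduct_smul, smul_eq_mul,
      dotProduct_comm y x]
    field_simp
    ring
  linarith

lemma posSemidef_iff_transpose_eq_and_dotProduct_nonneg {M : Matrix n n ℝ} :
    M.PosSemidef ↔ Mᵀ = M ∧ ∀ x, 0 ≤ x ⬝ᵥ (M *ᵥ x) := by
  rw [posSemidef_iff_dotProduct_mulVec, IsHermitian, conjTranspose_eq_transpose_of_trivial]
  simp only [star_trivial]

open scoped Matrix.Norms.L2Operator in
lemma dotProduct_mulVec_le_l2_opNorm [DecidableEq n] (M : Matrix n n ℝ) (x : n → ℝ) :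
    x ⬝ᵥ (M *ᵥ x) ≤ ‖M‖ * (x ⬝ᵥ x) := by
  have hinner : x ⬝ᵥ (M *ᵥ x) = inner ℝ (WithLp.toLp 2 x) (WithLp.toLp 2 (M *ᵥ x)) := by
    rw [EuclideanSpace.inner_toLp_toLp, star_trivial, dotProduct_comm]
  calc x ⬝ᵥ (M *ᵥ x) ≤ euclNorm x * euclNorm (M *ᵥ x) := hinner.trans_le (real_inner_le_norm _ _)
    _ ≤ euclNorm x * (‖M‖ * euclNorm x) :=
        mul_le_mul_of_nonneg_left (l2_opNorm_mulVec M (WithLp.toLp 2 x)) (norm_nonneg _)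
    _ = ‖M‖ * (x ⬝ᵥ x) := by
        rw [dotProduct_self_eq_euclNorm_sq]
        ring

variable [DecidableEq n] {M : Matrix n n ℝ} {c : ℝ}

lemma loewnerGE_iff : LoewnerGE M c ↔ Mᵀ = M ∧ ∀ x, c * (x ⬝ᵥ x) ≤ x ⬝ᵥ (M *ᵥ x) := by
  rw [LoewnerGE, posSemidef_iff_transpose_eq_and_dotProduct_nonneg]
  simp [sub_mulVec, smul_mulVec, dotProduct_sub]

lemma loewnerLE_iff : LoewnerLE M c ↔ Mᵀ = M ∧ ∀ x, x ⬝ᵥ (M *ᵥ x) ≤ c * (x ⬝ᵥ x) := by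
  rw [LoewnerLE, posSemidef_iff_transpose_eq_and_dotProduct_nonneg]
  simp [sub_mulVec, smul_mulVec, dotProduct_sub]

lemma LoewnerGE.le_dotProduct (h : LoewnerGE M c) (x : n → ℝ) :
    c * (x ⬝ᵥ x) ≤ x ⬝ᵥ (M *ᵥ x) := (loewnerGE_iff.1 h).2 x

lemma LoewnerLE.dotProduct_le (h : LoewnerLE M c) (x : n → ℝ) :
    x ⬝ᵥ (M *ᵥ x) ≤ c * (x ⬝ᵥ x) := (loewnerLE_iff.1 h).2 x

lemma isUnit_of_dotProduct_mulVec_pos {N : Matrix n n ℝ}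
    (h : ∀ v, v ≠ 0 → 0 < (M *ᵥ v) ⬝ᵥ (N *ᵥ v)) : IsUnit N := by
  refine mulVec_injective_iff_isUnit.1 ((injective_iff_map_eq_zero N.mulVecLin).2 fun v hv => ?_)
  by_contra hne
  have hpos := h v hne
  rw [mulVecLin_apply] at hv
  simp only [hv, dotProduct_zero, lt_irrefl] at hpos

lemma LoewnerGE.isUnit (h : LoewnerGE M c) (hc : 0 < c) : IsUnit M :=
  isUnit_of_dotProduct_mulVec_pos (M := 1) fun v hv => by
    rw [one_mulVec]
    have hvv : 0 < v ⬝ᵥ v :=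
      (dotProduct_self_nonneg_real v).lt_of_ne' (mt dotProduct_self_eq_zero.1 hv)
    exact (mul_pos hc hvv).trans_le (h.le_dotProduct v)

end QuadraticForms

open scoped MatrixOrder Matrix.Norms.L2Operator in
lemma exists_loewnerGE_of_posDef {n : Type*} [Finite n] [DecidableEq n] {M : Matrix n n ℝ}
    (hM : M.PosDef) : ∃ c, 0 < c ∧ LoewnerGE M c := by
  have := Fintype.ofFinite n
  cases isEmpty_or_nonempty n
  · exact ⟨1, one_pos, loewnerGE_iff.2 ⟨Subsingleton.elim _ _, by simp⟩⟩
  have hpos := isStrictlyPositive_iff_posDef.2 hM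
  obtain ⟨c, hc, hle⟩ := (CFC.exists_pos_algebraMap_le_iff hpos.isSelfAdjoint).2
    fun x hx => hpos.spectrum_pos hx
  rw [Matrix.le_iff, Algebra.algebraMap_eq_smul_one] at hle
  exact ⟨c, hc, hle⟩

open scoped Matrix.Norms.L2Operator in
lemma exists_loewnerLE_of_continuousOn {n : Type*} [Finite n] [DecidableEq n] {P : ℝ → Matrix n n ℝ}
    {K : Set ℝ} (hK : IsCompact K) (hP : ContinuousOn P K)
    (hsymm : ∀ t ∈ K, (P t)ᵀ = P t) :
    ∃ b, ∀ t ∈ K, LoewnerLE (P t) b := by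
  have := Fintype.ofFinite n
  obtain ⟨b, hb⟩ := hK.exists_bound_of_continuousOn hP
  exact ⟨b, fun t ht => loewnerLE_iff.2 ⟨hsymm t ht, fun x =>
    (dotProduct_mulVec_le_l2_opNorm _ _).trans
      (mul_le_mul_of_nonneg_right (hb t ht) (dotProduct_self_nonneg_real x))⟩⟩

/-! ### Linear matrix differential equations -/

section MatrixODE

variable {k m n : Type*} [Fintype m] [Fintype n] {a : ℝ}

lemma exists_matrix_solution {F : ℝ → Matrix n n ℝ} (hF : ContinuousOn F (Ici a))
    (X₀ : Matrix n k ℝ) :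
    ∃ X : ℝ → Matrix n k ℝ, X a = X₀ ∧
      ∀ t, a ≤ t → MatHasDerivWithinAt X (F t * X t) (Ici a) t := by
  choose x hx hxa using fun j : k => exists_isLinearSolution hF (X₀.col j)
  exact ⟨fun t => of fun i j => x j t i, ext fun i j => congrFun (hxa j) i,
    fun t ht i j => hasDerivWithinAt_pi.1 (hx j t ht) i⟩

open scoped Matrix.Norms.Operator in
lemma eq_zero_of_hasDerivWithinAt_sylvester {L : ℝ → Matrix m m ℝ}
    {R : ℝ → Matrix n n ℝ} {E : ℝ → Matrix m n ℝ}
    (hL : ContinuousOn L (Ici a)) (hR : ContinuousOn R (Ici a)) (hEa : E a = 0)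
    (hE : ∀ t, a ≤ t → MatHasDerivWithinAt E (L t * E t + E t * R t) (Ici a) t) {t : ℝ}
    (ht : a ≤ t) : E t = 0 := by
  obtain ⟨K, hK⟩ := isCompact_Icc.exists_bound_of_continuousOn
    ((hL.norm.add hR.norm).mono (Icc_subset_Ici_self : Icc a t ⊆ Ici a))
  have hderiv : ∀ s ∈ Icc a t, ‖L s * E s + E s * R s‖ ≤ K * ‖E s‖ := fun s hs =>
    calc ‖L s * E s + E s * R s‖ ≤ ‖L s * E s‖ + ‖E s * R s‖ := norm_add_le _ _
      _ ≤ ‖L s‖ * ‖E s‖ + ‖E s‖ * ‖R s‖ :=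
          add_le_add (linfty_opNorm_mul _ _) (linfty_opNorm_mul _ _)
      _ = (‖L s‖ + ‖R s‖) * ‖E s‖ := by ring
      _ ≤ K * ‖E s‖ :=
          mul_le_mul_of_nonneg_right ((Real.le_norm_self _).trans (hK s hs)) (norm_nonneg _)
  have hnorm := norm_le_norm_mul_exp
    (fun s hs => matHasDerivWithinAt_iff.1 ((hE s hs.1).mono Icc_subset_Ici_self)) hderiv
    (right_mem_Icc.2 ht)
  simpa [hEa] using hnorm

end MatrixODE

/-! ### The Riccati equation -/

section Riccati

variable {m n : Type*} [Fintype m] [Fintype n] {a : ℝ}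
  {A G S : ℝ → Matrix n n ℝ} {C : ℝ → Matrix m n ℝ} {D : ℝ → Matrix m m ℝ}

lemma IsRiccatiSolution.continuousOn {P : ℝ → Matrix n n ℝ} (hP : IsRiccatiSolution A C D S P) :
    ContinuousOn P (Ici 0) :=
  MatHasDerivWithinAt.continuousOn hP

theorem IsRiccatiSolution.eqOn {P P' : ℝ → Matrix n n ℝ} (hA : ContinuousOn A (Ici 0))
    (hC : ContinuousOn C (Ici 0)) (hD : ContinuousOn D (Ici 0))
    (hP : IsRiccatiSolution A C D S P) (hP' : IsRiccatiSolution A C D S P') (h0 : P 0 = P' 0) :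
    EqOn P P' (Ici 0) := by
  have hG := continuousOn_transpose_mul_mul hC hD
  have hL : ContinuousOn (fun t => A t - P' t * ((C t)ᵀ * D t * C t)) (Ici 0) :=
    hA.sub (continuousOn_matrix_mul hP'.continuousOn hG)
  have hR : ContinuousOn (fun t => (A t)ᵀ - (C t)ᵀ * D t * C t * P t) (Ici 0) :=
    (continuousOn_matrix_transpose hA).sub (continuousOn_matrix_mul hG hP.continuousOn)
  refine fun t ht => sub_eq_zero.1 (eq_zero_of_hasDerivWithinAt_sylvester
    (E := fun t => P t - P' t) hL hR (sub_eq_zero.2 h0) (fun t ht => ?_) ht)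
  convert (hP t ht).sub (hP' t ht) using 1
  simp only [Matrix.sub_mul, Matrix.mul_sub, ← Matrix.mul_assoc]
  abel

lemma IsRiccatiSolution.transpose {P : ℝ → Matrix n n ℝ} (hD : ∀ t, 0 ≤ t → (D t)ᵀ = D t)
    (hS : ∀ t, 0 ≤ t → (S t)ᵀ = S t) (hP : IsRiccatiSolution A C D S P) :
    IsRiccatiSolution A C D S fun t => (P t)ᵀ := fun t ht => by
  convert (hP t ht).transpose using 1
  simp only [transpose_add, transpose_sub, transpose_mul, transpose_transpose, hD t ht, hS t ht,
    Matrix.mul_assoc]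
  abel

/-- The Hamiltonian system `Ẋ = A X + S Y`, `Ẏ = G X - Aᵀ Y` on `[a, ∞)`. For `G = Cᵀ D C` the
quotient `X Y⁻¹` solves the Riccati equation; for `S = 0` the pair yields controls of the adjoint
system `ẏ = -Aᵀ y - Cᵀ u`. -/
structure IsHamiltonianPair (A G S : ℝ → Matrix n n ℝ) (a : ℝ) (X Y : ℝ → Matrix n n ℝ) :
    Prop where
  left : ∀ t, a ≤ t → MatHasDerivWithinAt X (A t * X t + S t * Y t) (Ici a) t
  right : ∀ t, a ≤ t → MatHasDerivWithinAt Y (G t * X t - (A t)ᵀ * Y t) (Ici a) t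

lemma exists_isHamiltonianPair (hA : ContinuousOn A (Ici a)) (hG : ContinuousOn G (Ici a))
    (hS : ContinuousOn S (Ici a)) (X₀ Y₀ : Matrix n n ℝ) :
    ∃ X Y, IsHamiltonianPair A G S a X Y ∧ X a = X₀ ∧ Y a = Y₀ := by
  have hF : ContinuousOn (fun t => fromBlocks (A t) (S t) (G t) (-(A t)ᵀ)) (Ici a) := by
    rw [continuousOn_iff_continuous_domRestrict] at *
    exact Continuous.matrix_fromBlocks hA hS hG (Continuous.matrix_transpose hA).neg
  obtain ⟨Z, hZa, hZ⟩ := exists_matrix_solution hF (fromRows X₀ Y₀)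
  have hblock (t : ℝ) : fromBlocks (A t) (S t) (G t) (-(A t)ᵀ) * Z t =
      fromRows (A t * (Z t).toRows₁ + S t * (Z t).toRows₂)
        (G t * (Z t).toRows₁ - (A t)ᵀ * (Z t).toRows₂) := by
    conv_lhs => rw [← fromRows_toRows (Z t)]
    rw [fromBlocks_mul_fromRows, Matrix.neg_mul, sub_eq_add_neg]
  refine ⟨fun t => (Z t).toRows₁, fun t => (Z t).toRows₂, ⟨fun t ht i j => ?_, fun t ht i j => ?_⟩,
    by simp only [hZa, toRows₁_fromRows], by simp only [hZa, toRows₂_fromRows]⟩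
  · simpa only [hblock, fromRows_apply_inl, toRows₁_apply] using hZ t ht (Sum.inl i) j
  · simpa only [hblock, fromRows_apply_inr, toRows₂_apply] using hZ t ht (Sum.inr i) j

lemma IsHamiltonianPair.hasDerivWithinAt_dotProduct {X Y : ℝ → Matrix n n ℝ}
    (h : IsHamiltonianPair A G S a X Y) (v : n → ℝ) {t : ℝ} (ht : a ≤ t) :
    HasDerivWithinAt (fun t => (X t *ᵥ v) ⬝ᵥ (Y t *ᵥ v))
      ((S t *ᵥ Y t *ᵥ v) ⬝ᵥ (Y t *ᵥ v) + (X t *ᵥ v) ⬝ᵥ (G t *ᵥ X t *ᵥ v)) (Ici a) t := by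
  have hv := hasDerivWithinAt_const t (Ici a) v
  convert _root_.hasDerivWithinAt_dotProduct ((h.left t ht).mulVec hv) ((h.right t ht).mulVec hv)
    using 1
  simp only [mulVec_zero, add_zero, add_mulVec, sub_mulVec, ← mulVec_mulVec, add_dotProduct,
    dotProduct_sub, dotProduct_transpose_mulVec, dotProduct_comm (Y t *ᵥ v) (A t *ᵥ _)]
  ring

lemma IsHamiltonianPair.isUnit_right [DecidableEq n] {X Y : ℝ → Matrix n n ℝ}
    (h : IsHamiltonianPair A G S a X Y) (hG : ∀ t, a ≤ t → (G t).PosSemidef)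
    (hS : ∀ t, a ≤ t → (S t).PosSemidef) (hX : (X a).PosDef) (hY : Y a = 1) {t : ℝ}
    (ht : a ≤ t) : IsUnit (Y t) := by
  refine isUnit_of_dotProduct_mulVec_pos (M := X t) fun v hv => ?_
  have hinit : 0 < (X a *ᵥ v) ⬝ᵥ (Y a *ᵥ v) := by
    rw [hY, one_mulVec, dotProduct_comm]
    simpa only [star_trivial] using hX.dotProduct_mulVec_pos hv
  refine hinit.trans_le (le_of_hasDerivWithinAt_nonneg ht
    (fun s hs => (h.hasDerivWithinAt_dotProduct v hs.1).mono Icc_subset_Ici_self) fun s hs => ?_)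
  rw [dotProduct_comm (S s *ᵥ _)]
  exact add_nonneg (by simpa only [star_trivial] using (hS s hs.1).dotProduct_mulVec_nonneg _)
    (by simpa only [star_trivial] using (hG s hs.1).dotProduct_mulVec_nonneg _)

lemma IsHamiltonianPair.isRiccatiSolution [DecidableEq n] {X Y : ℝ → Matrix n n ℝ}
    (h : IsHamiltonianPair A (fun t => (C t)ᵀ * D t * C t) S 0 X Y)
    (hY : ∀ t, 0 ≤ t → IsUnit (Y t)) :
    IsRiccatiSolution A C D S fun t => X t * (Y t)⁻¹ := fun t ht => by
  convert (h.left t ht).mul ((h.right t ht).inv (hY t ht)) using 1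
  have hcancel (N : Matrix n n ℝ) : N * Y t * (Y t)⁻¹ = N :=
    mul_nonsing_inv_cancel_right _ _ ((isUnit_iff_isUnit_det _).1 (hY t ht))
  simp only [Matrix.add_mul, Matrix.mul_sub, Matrix.sub_mul, Matrix.mul_neg, ← Matrix.mul_assoc,
    hcancel]
  abel

theorem exists_isRiccatiSolution (hA : ContinuousOn A (Ici 0))
    (hC : ContinuousOn C (Ici 0)) (hD : ContinuousOn D (Ici 0)) (hS : ContinuousOn S (Ici 0))
    (hDpos : ∀ t, 0 ≤ t → (D t).PosSemidef) (hSpos : ∀ t, 0 ≤ t → (S t).PosSemidef)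
    {P₀ : Matrix n n ℝ} (hP₀ : P₀.PosDef) : ∃ P, IsRiccatiSolution A C D S P ∧ P 0 = P₀ := by
  classical
  obtain ⟨X, Y, hXY, hX0, hY0⟩ := exists_isHamiltonianPair hA
    (continuousOn_transpose_mul_mul hC hD) hS P₀ 1
  have hY : ∀ t, 0 ≤ t → IsUnit (Y t) := fun t ht => hXY.isUnit_right
    (fun t ht => by simpa using (hDpos t ht).conjTranspose_mul_mul_same (C t)) hSpos
    (hX0 ▸ hP₀) hY0 ht
  exact ⟨_, hXY.isRiccatiSolution hY, by simp [hX0, hY0]⟩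

end Riccati

/-! ### Uniform bounds for the Riccati equation -/

section Bounds

variable {m n : Type*} [Fintype m] [Fintype n] {M : ℝ} {A S P : ℝ → Matrix n n ℝ}
  {C : ℝ → Matrix m n ℝ} {D : ℝ → Matrix m m ℝ}

lemma le_mul_exp_of_hasDerivWithinAt_le {f f' : ℝ → ℝ} {a b k : ℝ} (hab : a ≤ b)
    (hf : ∀ t ∈ Icc a b, HasDerivWithinAt f (f' t) (Icc a b) t)
    (hf' : ∀ t ∈ Icc a b, f' t ≤ k * f t) : f b ≤ f a * Real.exp (k * (b - a)) := by
  rw [← gronwallBound_ε0]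
  refine le_gronwallBound_of_liminf_deriv_right_le (f' := f')
    (fun t ht => (hf t ht).continuousWithinAt) (fun t ht r hr => ?_) le_rfl
    (fun t ht => by simpa using hf' t (Ico_subset_Icc_self ht)) b (right_mem_Icc.2 hab)
  have hright := (hf t (Ico_subset_Icc_self ht)).mono_of_mem_nhdsWithin
    (Icc_mem_nhdsGE_of_mem ht)
  simpa only [slope_def_field, div_eq_inv_mul] using hright.liminf_right_slope_le hr

/-- A continuous pair on `[0, ∞)` whose state and output matrices obey one quadratic-form bound. -/
structure IsBoundedPair (A : ℝ → Matrix n n ℝ) (C : ℝ → Matrix m n ℝ) (M : ℝ) : Prop where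
  nonneg : 0 ≤ M
  continuousOn_state : ContinuousOn A (Ici 0)
  continuousOn_output : ContinuousOn C (Ici 0)
  abs_dotProduct_le : ∀ t, 0 ≤ t → ∀ x, |x ⬝ᵥ (A t *ᵥ x)| ≤ M * (x ⬝ᵥ x)
  output_le : ∀ t, 0 ≤ t → ∀ x, (C t *ᵥ x) ⬝ᵥ (C t *ᵥ x) ≤ M * (x ⬝ᵥ x)

/-- `z` solves the adjoint control system `ż = -Aᵀ z - Cᵀ u` on `s`, driven by the input `u`. -/
def IsAdjointSolution (A : ℝ → Matrix n n ℝ) (C : ℝ → Matrix m n ℝ) (u : ℝ → m → ℝ)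
    (s : Set ℝ) (z : ℝ → n → ℝ) : Prop :=
  ∀ t ∈ s, HasDerivWithinAt z (-((A t)ᵀ *ᵥ z t) - (C t)ᵀ *ᵥ u t) s t

lemma IsAdjointSolution.hasDerivWithinAt_dotProduct_self {u : ℝ → m → ℝ} {z : ℝ → n → ℝ}
    {s : Set ℝ} (hz : IsAdjointSolution A C u s z) {t : ℝ} (ht : t ∈ s) :
    HasDerivWithinAt (fun t => z t ⬝ᵥ z t)
      (-2 * (z t ⬝ᵥ (A t *ᵥ z t)) - 2 * ((C t *ᵥ z t) ⬝ᵥ u t)) s t := by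
  convert hasDerivWithinAt_dotProduct (hz t ht) (hz t ht) using 1
  rw [dotProduct_comm _ (z t), dotProduct_sub, dotProduct_neg, dotProduct_transpose_mulVec,
    dotProduct_transpose_mulVec, dotProduct_comm (u t)]
  ring

lemma IsRiccatiSolution.hasDerivWithinAt_dotProduct (hP : IsRiccatiSolution A C D S P)
    {u : ℝ → m → ℝ} {z : ℝ → n → ℝ} {s : Set ℝ} (hs : s ⊆ Ici 0)
    (hz : IsAdjointSolution A C u s z) {t : ℝ} (ht : t ∈ s) (hsymm : (P t)ᵀ = P t) :
    HasDerivWithinAt (fun t => z t ⬝ᵥ (P t *ᵥ z t))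
      (z t ⬝ᵥ (S t *ᵥ z t) - (C t *ᵥ P t *ᵥ z t) ⬝ᵥ (D t *ᵥ C t *ᵥ P t *ᵥ z t) -
        2 * ((C t *ᵥ P t *ᵥ z t) ⬝ᵥ u t)) s t := by
  convert _root_.hasDerivWithinAt_dotProduct (hz t ht)
    (((hP t (hs ht)).mono hs).mulVec (hz t ht)) using 1
  have hmove (x y : n → ℝ) : x ⬝ᵥ (P t *ᵥ y) = y ⬝ᵥ (P t *ᵥ x) := by
    conv_lhs => rw [← hsymm]
    exact dotProduct_transpose_mulVec _ _ _
  simp only [add_mulVec, sub_mulVec, ← mulVec_mulVec, dotProduct_add, dotProduct_sub, mulVec_sub,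
    mulVec_neg, dotProduct_neg, hmove (z t), dotProduct_comm _ (P t *ᵥ z t),
    dotProduct_transpose_mulVec]
  simp only [dotProduct_comm (u t), dotProduct_comm (D t *ᵥ _)]
  ring

lemma exists_isAdjointSolution_feedback (hA : ContinuousOn A (Ici 0))
    (hC : ContinuousOn C (Ici 0)) (hD : ContinuousOn D (Ici 0)) (hP : ContinuousOn P (Ici 0))
    (ε : ℝ) {T : ℝ} (hT : 0 ≤ T) (w : n → ℝ) :
    ∃ u z, IsAdjointSolution A C u (Icc 0 T) z ∧ z T = w ∧
      ∀ t, u t = -((1 / 2 : ℝ) • (D t *ᵥ (C t *ᵥ P t *ᵥ z t + ε • (C t *ᵥ z t)))) := by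
  have hG := continuousOn_transpose_mul_mul hC hD
  have hF : ContinuousOn (fun t => -(A t)ᵀ + (1 / 2 : ℝ) •
      ((C t)ᵀ * D t * C t * P t + ε • ((C t)ᵀ * D t * C t))) (Icc 0 T) :=
    ((continuousOn_matrix_transpose hA).neg.add (((continuousOn_matrix_mul hG hP).add
      (hG.const_smul ε)).const_smul (1 / 2 : ℝ))).mono Icc_subset_Ici_self
  obtain ⟨z, hz, hzT⟩ := exists_isLinearSolutionOn_Icc_of_terminal hT hF w
  refine ⟨fun t => _, z, fun t ht => ?_, hzT, fun t => rfl⟩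
  convert hz t ht using 1
  simp only [add_mulVec, neg_mulVec, smul_mulVec, mulVec_neg, mulVec_smul, mulVec_add,
    ← mulVec_mulVec, sub_neg_eq_add]

lemma IsRiccatiSolution.dotProduct_sub_le_of_feedback [DecidableEq n] [DecidableEq m]
    (h : IsBoundedPair A C M) (hP : IsRiccatiSolution A C D S P)
    (hsymm : ∀ t, 0 ≤ t → (P t)ᵀ = P t) (hDsymm : ∀ t, 0 ≤ t → (D t)ᵀ = D t) {a d ε T : ℝ}
    (hS : ∀ t, 0 ≤ t → LoewnerGE (S t) a) (hD : ∀ t, 0 ≤ t → LoewnerLE (D t) d) (hd : 0 ≤ d)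
    (hε : 0 ≤ ε) (hε1 : ε ≤ 1) (hεa : ε * (2 * M + d * M) ≤ a) (hT : 0 ≤ T)
    {u : ℝ → m → ℝ} {z : ℝ → n → ℝ} (hz : IsAdjointSolution A C u (Icc 0 T) z)
    (hu : ∀ t, u t = -((1 / 2 : ℝ) • (D t *ᵥ (C t *ᵥ P t *ᵥ z t + ε • (C t *ᵥ z t))))) :
    z 0 ⬝ᵥ (P 0 *ᵥ z 0) - ε * (z 0 ⬝ᵥ z 0) ≤ z T ⬝ᵥ (P T *ᵥ z T) - ε * (z T ⬝ᵥ z T) := by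
  refine le_of_hasDerivWithinAt_nonneg hT (fun t ht =>
    (hP.hasDerivWithinAt_dotProduct Icc_subset_Ici_self hz ht (hsymm t ht.1)).sub
      ((hz.hasDerivWithinAt_dotProduct_self ht).const_mul ε)) fun t ht => ?_
  have hDcomm : (C t *ᵥ P t *ᵥ z t) ⬝ᵥ (D t *ᵥ C t *ᵥ z t) =
      (C t *ᵥ z t) ⬝ᵥ (D t *ᵥ C t *ᵥ P t *ᵥ z t) := by
    conv_lhs => rw [← hDsymm t ht.1]
    exact dotProduct_transpose_mulVec _ _ _
  have hSz := (hS t ht.1).le_dotProduct (z t)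
  have hAz := neg_le_of_abs_le (h.abs_dotProduct_le t ht.1 (z t))
  have hDz : (C t *ᵥ z t) ⬝ᵥ (D t *ᵥ C t *ᵥ z t) ≤ d * M * (z t ⬝ᵥ z t) :=
    ((hD t ht.1).dotProduct_le _).trans <| (mul_le_mul_of_nonneg_left
      (h.output_le t ht.1 _) hd).trans_eq (mul_assoc _ _ _).symm
  have hzz := dotProduct_self_nonneg_real (z t)
  -- With `u = -½ D (C P z + ε C z)` the cross terms sum to `|C P z|² - ε² |C z|²` in the norm of
  -- `D`, and the first square cancels the quadratic term of the Riccati equation.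
  simp only [hu t, dotProduct_neg, dotProduct_smul, mulVec_add, mulVec_smul, dotProduct_add,
    smul_eq_mul, hDcomm]
  nlinarith [mul_le_mul_of_nonneg_right hεa hzz, mul_le_mul_of_nonneg_left hAz hε,
    mul_le_mul_of_nonneg_left hDz (sq_nonneg ε),
    mul_le_mul_of_nonneg_right (mul_le_mul_of_nonneg_left hε1 hε)
      (mul_nonneg (mul_nonneg hd h.nonneg) hzz)]

theorem IsRiccatiSolution.exists_loewnerGE [DecidableEq n] [DecidableEq m]
    (h : IsBoundedPair A C M) (hD : IsWeight D) (hS : IsWeight S)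
    (hP : IsRiccatiSolution A C D S P) (hsymm : ∀ t, 0 ≤ t → (P t)ᵀ = P t) (hP0 : (P 0).PosDef) :
    ∃ ε, 0 < ε ∧ ∀ t, 0 ≤ t → LoewnerGE (P t) ε := by
  obtain ⟨ε₀, hε₀, hP0⟩ := exists_loewnerGE_of_posDef hP0
  obtain ⟨a, _, ha, -, hSa⟩ := hS.exists_bounds
  obtain ⟨_, d, -, hd, hDd⟩ := hD.exists_bounds
  have hM := h.nonneg
  set κ : ℝ := 2 * M + d * M
  have hκ : 0 < κ + 1 := by positivity
  set ε : ℝ := min ε₀ (min 1 (a / (κ + 1)))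
  have hε : 0 < ε := lt_min hε₀ (lt_min one_pos (div_pos ha hκ))
  have hεa : ε * (κ + 1) ≤ a :=
    (le_div_iff₀ hκ).1 ((min_le_right _ _).trans (min_le_right _ _))
  refine ⟨ε, hε, fun T hT => loewnerGE_iff.2 ⟨hsymm T hT, fun w => ?_⟩⟩
  obtain ⟨u, z, hz, rfl, hu⟩ := exists_isAdjointSolution_feedback h.continuousOn_state
    h.continuousOn_output hD.1 hP.continuousOn ε hT w
  have hmono := hP.dotProduct_sub_le_of_feedback h hsymm (fun _ => hD.transpose_eq)
    (fun t ht => (hSa t ht).1) (fun t ht => (hDd t ht).2) hd.le hε.le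
    ((min_le_right _ _).trans (min_le_left _ _)) (by linarith) hT hz hu
  have hinit := (hP0.mono (min_le_left ε₀ (min 1 (a / (κ + 1))))).le_dotProduct (z 0)
  linarith

lemma IsTransitionMatrix.eqOn [DecidableEq n] (hA : ContinuousOn A (Ici 0))
    {Φ : ℝ → ℝ → Matrix n n ℝ} (hΦ : IsTransitionMatrix A Φ) {t₀ : ℝ} (ht₀ : 0 ≤ t₀)
    {X : ℝ → Matrix n n ℝ} (hX₀ : X t₀ = 1)
    (hX : ∀ t, t₀ ≤ t → MatHasDerivWithinAt X (A t * X t) (Ici t₀) t) :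
    EqOn (fun t => Φ t t₀) X (Ici t₀) := by
  have hsub : Ici t₀ ⊆ Ici 0 := Ici_subset_Ici.2 ht₀
  refine fun t ht => sub_eq_zero.1 (eq_zero_of_hasDerivWithinAt_sylvester
    (E := fun t => Φ t t₀ - X t) (R := 0) (hA.mono hsub) continuousOn_const
    (sub_eq_zero.2 ((hΦ t₀ ht₀).1.trans hX₀.symm)) (fun s hs => ?_) ht)
  convert (((hΦ t₀ ht₀).2 s (hsub hs)).mono hsub).sub (hX s hs) using 1
  simp only [Pi.zero_apply, Matrix.mul_zero, add_zero, Matrix.mul_sub]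

lemma IsHamiltonianPair.smul_gramian_eq [DecidableEq n] (hA : ContinuousOn A (Ici 0))
    (hC : ContinuousOn C (Ici 0)) {Φ : ℝ → ℝ → Matrix n n ℝ} (hΦ : IsTransitionMatrix A Φ)
    {t₀ δ : ℝ} (ht₀ : 0 ≤ t₀) (hδ : 0 < δ) {X Y : ℝ → Matrix n n ℝ}
    (hXY : IsHamiltonianPair A (fun t => (C t)ᵀ * C t) 0 t₀ X Y) (hX₀ : X t₀ = 1)
    (hY₀ : Y t₀ = 0) : δ • gramian Φ C t₀ δ = (X (t₀ + δ))ᵀ * Y (t₀ + δ) := by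
  have hle : t₀ ≤ t₀ + δ := by linarith
  have hX (t : ℝ) (ht : t₀ ≤ t) : MatHasDerivWithinAt X (A t * X t) (Ici t₀) t := by
    simpa using hXY.left t ht
  have hderiv (t : ℝ) (ht : t ∈ Icc t₀ (t₀ + δ)) : MatHasDerivWithinAt (fun t => (X t)ᵀ * Y t)
      ((Φ t t₀)ᵀ * (C t)ᵀ * C t * Φ t t₀) (Icc t₀ (t₀ + δ)) t := by
    rw [show Φ t t₀ = X t from hΦ.eqOn hA ht₀ hX₀ hX ht.1]
    convert ((hX t ht.1).transpose.mul (hXY.right t ht.1)).mono Icc_subset_Ici_self using 1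
    simp only [transpose_mul, Matrix.mul_sub, Matrix.mul_assoc]
    abel
  have hΦcont : ContinuousOn (fun t => Φ t t₀) (Ici 0) :=
    MatHasDerivWithinAt.continuousOn (hΦ t₀ ht₀).2
  have hcont : ContinuousOn (fun t => (Φ t t₀)ᵀ * (C t)ᵀ * C t * Φ t t₀) (Ici 0) :=
    continuousOn_matrix_mul (continuousOn_matrix_mul (continuousOn_matrix_mul
      (continuousOn_matrix_transpose hΦcont) (continuousOn_matrix_transpose hC)) hC) hΦcont
  rw [gramian, smul_smul, mul_one_div_cancel hδ.ne', one_smul,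
    matIntegral_eq_sub_of_hasDerivWithinAt hle hderiv
      (hcont.mono fun t ht => ht₀.trans ht.1), hY₀, Matrix.mul_zero, sub_zero]

lemma IsBoundedPair.dotProduct_self_le (h : IsBoundedPair A C M) {a b : ℝ} (ha : 0 ≤ a)
    (hab : a ≤ b) {x : ℝ → n → ℝ} (hx : IsLinearSolutionOn A (Icc a b) x) :
    x b ⬝ᵥ x b ≤ x a ⬝ᵥ x a * Real.exp (2 * M * (b - a)) :=
  le_mul_exp_of_hasDerivWithinAt_le hab
    (fun t ht => hasDerivWithinAt_dotProduct (hx t ht) (hx t ht)) fun t ht => by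
      have hAx := le_of_abs_le (h.abs_dotProduct_le t (ha.trans ht.1) (x t))
      rw [dotProduct_comm _ (x t)]
      linarith

lemma IsBoundedPair.adjoint_dotProduct_self_le (h : IsBoundedPair A C M) {a b U : ℝ} (ha : 0 ≤ a)
    (hab : a ≤ b) (hU : 0 ≤ U) {u : ℝ → m → ℝ} {z : ℝ → n → ℝ}
    (hz : IsAdjointSolution A C u (Icc a b) z) (hza : z a = 0)
    (hu : ∀ t ∈ Icc a b, u t ⬝ᵥ u t ≤ U) :
    z b ⬝ᵥ z b ≤ U * Real.exp ((3 * M + 1) * (b - a)) := by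
  have hexp := le_mul_exp_of_hasDerivWithinAt_le (f := fun t => z t ⬝ᵥ z t + U) (k := 3 * M + 1)
    hab (fun t ht => (hz.hasDerivWithinAt_dotProduct_self ht).add_const U) fun t ht => by
      have ht0 := ha.trans ht.1
      have hAz := neg_le_of_abs_le (h.abs_dotProduct_le t ht0 (z t))
      have hCz := h.output_le t ht0 (z t)
      have hcross := two_mul_dotProduct_le one_pos (-(C t *ᵥ z t)) (u t)
      simp only [neg_dotProduct, dotProduct_neg, neg_neg, inv_one, one_mul] at hcross
      have hzz := dotProduct_self_nonneg_real (z t)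
      linarith [hu t ht, mul_nonneg h.nonneg hU]
  simp only [hza, dotProduct_zero, zero_add] at hexp
  linarith

lemma dotProduct_self_le_of_gramian {X Y : Matrix n n ℝ} {c ρ : ℝ} (hc : 0 < c)
    (hρ : 0 < ρ) (hXY : ∀ v, c * (v ⬝ᵥ v) ≤ (X *ᵥ v) ⬝ᵥ (Y *ᵥ v))
    (hX : ∀ v, (X *ᵥ v) ⬝ᵥ (X *ᵥ v) ≤ ρ * (v ⬝ᵥ v)) (w : n → ℝ) :
    ∃ v, Y *ᵥ v = w ∧ v ⬝ᵥ v ≤ ρ / c ^ 2 * (w ⬝ᵥ w) := by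
  classical
  have hY : IsUnit Y := isUnit_of_dotProduct_mulVec_pos (M := X) fun v hv =>
    (mul_pos hc ((dotProduct_self_nonneg_real v).lt_of_ne'
      (mt dotProduct_self_eq_zero.1 hv))).trans_le (hXY v)
  obtain ⟨v, rfl⟩ := mulVec_surjective_iff_isUnit.2 hY w
  refine ⟨v, rfl, ?_⟩
  have hbound : c * (v ⬝ᵥ v) ≤ (c / ρ)⁻¹ * ((Y *ᵥ v) ⬝ᵥ (Y *ᵥ v)) := by
    have hcross := two_mul_dotProduct_le (div_pos hc hρ) (X *ᵥ v) (Y *ᵥ v)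
    have hXv : c / ρ * ((X *ᵥ v) ⬝ᵥ (X *ᵥ v)) ≤ c * (v ⬝ᵥ v) :=
      (mul_le_mul_of_nonneg_left (hX v) (div_pos hc hρ).le).trans_eq (by field_simp)
    linarith [hXY v]
  calc v ⬝ᵥ v = c⁻¹ * (c * (v ⬝ᵥ v)) := by field_simp
    _ ≤ c⁻¹ * ((c / ρ)⁻¹ * ((Y *ᵥ v) ⬝ᵥ (Y *ᵥ v))) :=
        mul_le_mul_of_nonneg_left hbound (inv_nonneg.2 hc.le)
    _ = ρ / c ^ 2 * ((Y *ᵥ v) ⬝ᵥ (Y *ᵥ v)) := by field_simp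

lemma UniformlyObservable.exists_isHamiltonianPair [DecidableEq n] (h : IsBoundedPair A C M)
    (hobs : UniformlyObservable A C) :
    ∃ δ ρ c : ℝ, 0 < δ ∧ 0 < ρ ∧ 0 < c ∧ ∀ t₀, 0 ≤ t₀ → ∃ X Y,
      IsHamiltonianPair A (fun t => (C t)ᵀ * C t) 0 t₀ X Y ∧ Y t₀ = 0 ∧
        (∀ v, c * (v ⬝ᵥ v) ≤ (X (t₀ + δ) *ᵥ v) ⬝ᵥ (Y (t₀ + δ) *ᵥ v)) ∧
        ∀ t ∈ Icc t₀ (t₀ + δ), ∀ v, (X t *ᵥ v) ⬝ᵥ (X t *ᵥ v) ≤ ρ * (v ⬝ᵥ v) := by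
  obtain ⟨Φ, hΦ, δ, μ, hδ, hμ, hgram⟩ := hobs
  refine ⟨δ, Real.exp (2 * M * δ), δ * μ, hδ, Real.exp_pos _, mul_pos hδ hμ, fun t₀ ht₀ => ?_⟩
  have hsub : Ici t₀ ⊆ Ici 0 := Ici_subset_Ici.2 ht₀
  obtain ⟨X, Y, hXY, hX₀, hY₀⟩ := _root_.exists_isHamiltonianPair (S := 0)
    (h.continuousOn_state.mono hsub)
    ((continuousOn_matrix_mul (continuousOn_matrix_transpose h.continuousOn_output)
      h.continuousOn_output).mono hsub) continuousOn_const 1 0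
  refine ⟨X, Y, hXY, hY₀, fun v => ?_, fun t ht v => ?_⟩
  · have hv := mul_le_mul_of_nonneg_left ((hgram t₀ ht₀).le_dotProduct v) hδ.le
    rwa [← smul_eq_mul δ (v ⬝ᵥ _), ← dotProduct_smul, ← smul_mulVec, hXY.smul_gramian_eq
      h.continuousOn_state h.continuousOn_output hΦ ht₀ hδ hX₀ hY₀, ← mulVec_mulVec,
      dotProduct_transpose_mulVec, dotProduct_comm (Y _ *ᵥ v), ← mul_assoc] at hv
  · have hXv : IsLinearSolutionOn A (Icc t₀ t) fun t => X t *ᵥ v := fun s hs => by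
      refine (((hXY.left s hs.1).mulVec (hasDerivWithinAt_const s _ v)).mono
        Icc_subset_Ici_self).congr_deriv ?_
      simp
    calc (X t *ᵥ v) ⬝ᵥ (X t *ᵥ v) ≤ v ⬝ᵥ v * Real.exp (2 * M * (t - t₀)) := by
          simpa [hX₀] using h.dotProduct_self_le ht₀ ht.1 hXv
      _ ≤ v ⬝ᵥ v * Real.exp (2 * M * δ) := by
          have hM := h.nonneg
          have hvv := dotProduct_self_nonneg_real v
          gcongr
          linarith [ht.2]
      _ = Real.exp (2 * M * δ) * (v ⬝ᵥ v) := mul_comm _ _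

theorem UniformlyObservable.exists_adjoint_control [DecidableEq n] (h : IsBoundedPair A C M)
    (hobs : UniformlyObservable A C) :
    ∃ δ K : ℝ, 0 < δ ∧ 0 ≤ K ∧ ∀ t₀, 0 ≤ t₀ → ∀ w, ∃ u z,
      IsAdjointSolution A C u (Icc t₀ (t₀ + δ)) z ∧ z t₀ = 0 ∧ z (t₀ + δ) = w ∧
        ∀ t ∈ Icc t₀ (t₀ + δ), z t ⬝ᵥ z t ≤ K * (w ⬝ᵥ w) ∧ u t ⬝ᵥ u t ≤ K * (w ⬝ᵥ w) := by
  obtain ⟨δ, ρ, c, hδ, hρ, hc, hpair⟩ := hobs.exists_isHamiltonianPair h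
  have hM := h.nonneg
  set U := M * (ρ * (ρ / c ^ 2))
  set E := Real.exp ((3 * M + 1) * δ)
  have hU : 0 ≤ U := by positivity
  refine ⟨δ, U * E, hδ, by positivity, fun t₀ ht₀ w => ?_⟩
  obtain ⟨X, Y, hXY, hY₀, hlower, hupper⟩ := hpair t₀ ht₀
  obtain ⟨v, rfl, hv⟩ := dotProduct_self_le_of_gramian hc hρ hlower
    (hupper _ (right_mem_Icc.2 (by linarith))) w
  set W := (Y (t₀ + δ) *ᵥ v) ⬝ᵥ (Y (t₀ + δ) *ᵥ v)
  have hW : 0 ≤ W := dotProduct_self_nonneg_real _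
  have hz : IsAdjointSolution A C (fun t => -(C t *ᵥ X t *ᵥ v)) (Icc t₀ (t₀ + δ))
      fun t => Y t *ᵥ v := fun t ht => by
    refine (((hXY.right t ht.1).mulVec (hasDerivWithinAt_const t _ v)).mono
      Icc_subset_Ici_self).congr_deriv ?_
    simp only [mulVec_neg, sub_mulVec, ← mulVec_mulVec, mulVec_zero, add_zero]
    abel
  have hu (t : ℝ) (ht : t ∈ Icc t₀ (t₀ + δ)) :
      (-(C t *ᵥ X t *ᵥ v)) ⬝ᵥ (-(C t *ᵥ X t *ᵥ v)) ≤ U * W := by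
    rw [neg_dotProduct_neg]
    calc _ ≤ M * ((X t *ᵥ v) ⬝ᵥ (X t *ᵥ v)) := h.output_le t (ht₀.trans ht.1) _
      _ ≤ M * (ρ * (ρ / c ^ 2 * W)) := by
          have := hupper t ht v
          gcongr
          exact this.trans (mul_le_mul_of_nonneg_left hv hρ.le)
      _ = U * W := by ring
  refine ⟨_, _, hz, by rw [hY₀, zero_mulVec], rfl, fun t ht => ⟨?_, (hu t ht).trans ?_⟩⟩
  · calc _ ≤ U * W * Real.exp ((3 * M + 1) * (t - t₀)) :=
          h.adjoint_dotProduct_self_le ht₀ ht.1 (by positivity)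
            (fun s hs => (hz s ⟨hs.1, hs.2.trans ht.2⟩).mono (Icc_subset_Icc_right ht.2))
            (by rw [hY₀, zero_mulVec]) fun s hs => hu s ⟨hs.1, hs.2.trans ht.2⟩
      _ ≤ U * W * E := by
          have hexp : (3 * M + 1) * (t - t₀) ≤ (3 * M + 1) * δ := by
            gcongr
            linarith [ht.2]
          exact mul_le_mul_of_nonneg_left (Real.exp_le_exp.2 hexp) (mul_nonneg hU hW)
      _ = U * E * W := by ring
  · have hE : 1 ≤ E := Real.one_le_exp (by positivity)
    exact mul_le_mul_of_nonneg_right (le_mul_of_one_le_right hU hE) hW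

theorem IsRiccatiSolution.exists_loewnerLE [DecidableEq n] [DecidableEq m]
    (h : IsBoundedPair A C M) (hobs : UniformlyObservable A C) (hD : IsWeight D) (hS : IsWeight S)
    (hP : IsRiccatiSolution A C D S P) (hsymm : ∀ t, 0 ≤ t → (P t)ᵀ = P t) :
    ∃ b, 0 < b ∧ ∀ t, 0 ≤ t → LoewnerLE (P t) b := by
  obtain ⟨δ, K, hδ, -, hcontrol⟩ := hobs.exists_adjoint_control h
  obtain ⟨d, _, hd, -, hDd⟩ := hD.exists_bounds
  obtain ⟨_, s, -, hs, hSs⟩ := hS.exists_bounds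
  obtain ⟨b₀, hb₀⟩ := exists_loewnerLE_of_continuousOn (K := Icc 0 δ) isCompact_Icc
    (hP.continuousOn.mono Icc_subset_Ici_self) fun t ht => hsymm t ht.1
  set c := s * K + d⁻¹ * K
  refine ⟨max b₀ (max (c * δ) 1), by positivity, fun t ht => ?_⟩
  rcases le_total t δ with htδ | htδ
  · exact (hb₀ t ⟨ht, htδ⟩).mono (le_max_left _ _)
  refine LoewnerLE.mono (c := c * δ) (loewnerLE_iff.2 ⟨hsymm t ht, fun w => ?_⟩)
    ((le_max_left _ _).trans (le_max_right _ _))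
  obtain ⟨t₀, rfl⟩ : ∃ t₀, t = t₀ + δ := ⟨t - δ, by ring⟩
  have ht₀ : 0 ≤ t₀ := by linarith
  obtain ⟨u, z, hz, hz₀, rfl, hzu⟩ := hcontrol t₀ ht₀ w
  set W := z (t₀ + δ) ⬝ᵥ z (t₀ + δ)
  have hmono := le_of_hasDerivWithinAt_nonneg (f := fun t => c * W * t - z t ⬝ᵥ (P t *ᵥ z t))
    (le_add_of_nonneg_right hδ.le : t₀ ≤ t₀ + δ)
    (fun t ht => ((hasDerivWithinAt_id t _).const_mul (c * W)).sub
      (hP.hasDerivWithinAt_dotProduct (fun t ht => ht₀.trans ht.1) hz ht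
        (hsymm t (ht₀.trans ht.1)))) fun t ht => by
    have ht0 := ht₀.trans ht.1
    have hSz := ((hSs t ht0).2.dotProduct_le (z t)).trans
      (mul_le_mul_of_nonneg_left (hzu t ht).1 hs.le)
    have hDq := (hDd t ht0).1.le_dotProduct (C t *ᵥ P t *ᵥ z t)
    have hqu := two_mul_dotProduct_le hd (-(C t *ᵥ P t *ᵥ z t)) (u t)
    have huu := mul_le_mul_of_nonneg_left (hzu t ht).2 (inv_nonneg.2 hd.le)
    simp only [neg_dotProduct, dotProduct_neg, neg_neg] at hqu
    linarith [show c * W = s * (K * W) + d⁻¹ * (K * W) by ring]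
  simp only [hz₀, zero_dotProduct] at hmono
  linarith

end Bounds

/-! ### Exponential stability of the Riccati observer -/

section Stability

variable {m n : Type*} [Fintype m] [Fintype n] [DecidableEq n] {M : ℝ} {A S P : ℝ → Matrix n n ℝ}
  {C : ℝ → Matrix m n ℝ} {D : ℝ → Matrix m m ℝ}

lemma mulVec_nonsing_inv_mulVec {Q : Matrix n n ℝ} (hQ : IsUnit Q) (x : n → ℝ) :
    Q *ᵥ Q⁻¹ *ᵥ x = x := by
  rw [mulVec_mulVec, mul_nonsing_inv _ ((isUnit_iff_isUnit_det _).1 hQ), one_mulVec]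

lemma LoewnerGE.inv {Q : Matrix n n ℝ} {c : ℝ} (h : LoewnerGE Q c) (hc : 0 < c) :
    LoewnerLE Q⁻¹ c⁻¹ := by
  refine loewnerLE_iff.2 ⟨by rw [transpose_nonsing_inv, h.transpose_eq], fun x => ?_⟩
  have hle := h.le_dotProduct (Q⁻¹ *ᵥ x)
  have hcross := two_mul_dotProduct_le hc (Q⁻¹ *ᵥ x) x
  rw [mulVec_nonsing_inv_mulVec (h.isUnit hc)] at hle
  rw [dotProduct_comm x]
  linarith

lemma LoewnerLE.inv {Q : Matrix n n ℝ} {b : ℝ} (h : LoewnerLE Q b) (hb : 0 < b)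
    (hQ : Q.PosSemidef) (hunit : IsUnit Q) : LoewnerGE Q⁻¹ b⁻¹ := by
  have hsymm : (Q⁻¹)ᵀ = Q⁻¹ := by rw [transpose_nonsing_inv, (loewnerLE_iff.1 h).1]
  refine loewnerGE_iff.2 ⟨hsymm, fun x => ?_⟩
  have hnonneg := (posSemidef_iff_transpose_eq_and_dotProduct_nonneg.1 hQ).2
    (Q⁻¹ *ᵥ x - b⁻¹ • x)
  have hcancel : (Q⁻¹ *ᵥ x) ⬝ᵥ (Q *ᵥ x) = x ⬝ᵥ x := by
    rw [← (loewnerLE_iff.1 h).1, dotProduct_transpose_mulVec, (loewnerLE_iff.1 h).1,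
      mulVec_nonsing_inv_mulVec hunit]
  have hupper : b⁻¹ * (b⁻¹ * (x ⬝ᵥ (Q *ᵥ x))) ≤ b⁻¹ * (x ⬝ᵥ x) := by
    refine mul_le_mul_of_nonneg_left ?_ (inv_nonneg.2 hb.le)
    rw [inv_mul_le_iff₀ hb]
    exact h.dotProduct_le x
  simp only [mulVec_sub, mulVec_smul, mulVec_nonsing_inv_mulVec hunit, dotProduct_sub,
    sub_dotProduct, dotProduct_smul, smul_dotProduct, smul_eq_mul, hcancel,
    dotProduct_comm (Q⁻¹ *ᵥ x) x] at hnonneg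
  linarith

theorem globallyExponentiallyStable_of_lyapunov {F L : ℝ → Matrix n n ℝ} {p q k : ℝ}
    (hF : ContinuousOn F (Ici 0)) (hp : 0 < p) (hq : 0 < q) (hk : 0 < k)
    (hlower : ∀ t, 0 ≤ t → LoewnerGE (L t) p) (hupper : ∀ t, 0 ≤ t → LoewnerLE (L t) q)
    (hdecay : ∀ t₀ x, 0 ≤ t₀ → IsLinearSolution F t₀ x → ∃ V' : ℝ → ℝ, ∀ t, t₀ ≤ t →
      HasDerivWithinAt (fun t => x t ⬝ᵥ (L t *ᵥ x t)) (V' t) (Ici t₀) t ∧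
        V' t ≤ -k * (x t ⬝ᵥ (L t *ᵥ x t))) :
    GloballyExponentiallyStable F := by
  refine ⟨√(q / p), k / 2, by positivity, by positivity, fun t₀ ht₀ x₀ =>
    ⟨exists_isLinearSolution (hF.mono (Ici_subset_Ici.2 ht₀)) x₀, ?_⟩⟩
  rintro x hx rfl t ht
  obtain ⟨V', hV'⟩ := hdecay t₀ x ht₀ hx
  have hV := le_mul_exp_of_hasDerivWithinAt_le ht
    (fun s hs => ((hV' s hs.1).1.mono Icc_subset_Ici_self)) fun s hs => (hV' s hs.1).2
  have hsq : p * euclNorm (x t) ^ 2 ≤ q * euclNorm (x t₀) ^ 2 * Real.exp (-k * (t - t₀)) := by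
    simp only [← dotProduct_self_eq_euclNorm_sq]
    exact ((hlower t (ht₀.trans ht)).le_dotProduct _).trans (hV.trans
      (mul_le_mul_of_nonneg_right ((hupper t₀ ht₀).dotProduct_le _) (Real.exp_nonneg _)))
  refine le_of_sq_le_sq ?_ (mul_nonneg (by positivity) (norm_nonneg _))
  have hexp : Real.exp (-(k / 2) * (t - t₀)) ^ 2 = Real.exp (-k * (t - t₀)) := by
    rw [← Real.exp_nat_mul]
    congr 1
    push_cast
    ring
  rw [mul_pow, mul_pow, Real.sq_sqrt (by positivity), hexp]
  calc euclNorm (x t) ^ 2 ≤ q * euclNorm (x t₀) ^ 2 * Real.exp (-k * (t - t₀)) / p :=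
        (le_div_iff₀' hp).2 hsq
    _ = q / p * Real.exp (-k * (t - t₀)) * euclNorm (x t₀) ^ 2 := by ring

lemma IsRiccatiSolution.hasDerivWithinAt_inv (hP : IsRiccatiSolution A C D S P) {t : ℝ}
    (ht : 0 ≤ t) (hunit : IsUnit (P t)) :
    MatHasDerivWithinAt (fun t => (P t)⁻¹)
      (-((P t)⁻¹ * A t) - (A t)ᵀ * (P t)⁻¹ + (C t)ᵀ * D t * C t - (P t)⁻¹ * S t * (P t)⁻¹)
      (Ici 0) t := by
  convert (hP t ht).inv hunit using 1
  have hdet := (isUnit_iff_isUnit_det _).1 hunit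
  have hleft (N : Matrix n n ℝ) : (P t)⁻¹ * (P t * N) = N := nonsing_inv_mul_cancel_left _ _ hdet
  have hright : P t * (P t)⁻¹ = 1 := mul_nonsing_inv _ hdet
  simp only [Matrix.mul_add, Matrix.mul_sub, Matrix.add_mul, Matrix.sub_mul, Matrix.mul_assoc,
    hleft, hright, Matrix.mul_one]
  abel

lemma IsRiccatiSolution.hasDerivWithinAt_lyapunov (hP : IsRiccatiSolution A C D S P) {t₀ t : ℝ}
    (ht₀ : 0 ≤ t₀) (ht : t₀ ≤ t) (hsymm : (P t)ᵀ = P t) (hunit : IsUnit (P t)) {x : ℝ → n → ℝ}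
    (hx : IsLinearSolution (fun t => A t - riccatiGain C D P t * C t) t₀ x) :
    HasDerivWithinAt (fun t => x t ⬝ᵥ ((P t)⁻¹ *ᵥ x t))
      (-(((P t)⁻¹ *ᵥ x t) ⬝ᵥ (S t *ᵥ (P t)⁻¹ *ᵥ x t)) - (C t *ᵥ x t) ⬝ᵥ (D t *ᵥ C t *ᵥ x t))
      (Ici t₀) t := by
  refine (_root_.hasDerivWithinAt_dotProduct (hx t ht) (((hP.hasDerivWithinAt_inv
    (ht₀.trans ht) hunit).mono (Ici_subset_Ici.2 ht₀)).mulVec (hx t ht))).congr_deriv ?_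
  have hmove (v : n → ℝ) : x t ⬝ᵥ ((P t)⁻¹ *ᵥ v) = v ⬝ᵥ ((P t)⁻¹ *ᵥ x t) := by
    rw [← dotProduct_transpose_mulVec, transpose_nonsing_inv, hsymm]
  have hgain (v : n → ℝ) : (P t *ᵥ v) ⬝ᵥ ((P t)⁻¹ *ᵥ x t) = x t ⬝ᵥ v := by
    rw [dotProduct_comm, ← hsymm, dotProduct_transpose_mulVec, hsymm,
      mulVec_nonsing_inv_mulVec hunit, dotProduct_comm]
  simp only [riccatiGain, add_mulVec, sub_mulVec, neg_mulVec, mulVec_sub, ← mulVec_mulVec,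
    dotProduct_add, dotProduct_sub, sub_dotProduct, dotProduct_neg, hmove, hgain,
    dotProduct_transpose_mulVec, dotProduct_comm (A t *ᵥ _), dotProduct_comm (D t *ᵥ _),
    dotProduct_comm (S t *ᵥ _)]
  ring

lemma IsRiccatiSolution.transpose_eq [DecidableEq m] (h : IsBoundedPair A C M) (hD : IsWeight D)
    (hS : IsWeight S) (hP : IsRiccatiSolution A C D S P) (hP0 : (P 0)ᵀ = P 0) {t : ℝ}
    (ht : 0 ≤ t) : (P t)ᵀ = P t :=
  (hP.transpose (fun _ => hD.transpose_eq) fun _ => hS.transpose_eq).eqOn h.continuousOn_state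
    h.continuousOn_output hD.1 hP hP0 ht

theorem IsRiccatiSolution.globallyExponentiallyStable [DecidableEq m] (h : IsBoundedPair A C M)
    (hobs : UniformlyObservable A C) (hD : IsWeight D) (hS : IsWeight S)
    (hP : IsRiccatiSolution A C D S P) (hP0 : (P 0).PosDef) :
    GloballyExponentiallyStable fun t => A t - riccatiGain C D P t * C t := by
  have hsymm (t : ℝ) (ht : 0 ≤ t) : (P t)ᵀ = P t :=
    hP.transpose_eq h hD hS hP0.isHermitian ht
  obtain ⟨ε, hε, hPε⟩ := hP.exists_loewnerGE h hD hS hsymm hP0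
  obtain ⟨b, hb, hPb⟩ := hP.exists_loewnerLE h hobs hD hS hsymm
  obtain ⟨a, _, ha, -, hSa⟩ := hS.exists_bounds
  have hunit (t : ℝ) (ht : 0 ≤ t) : IsUnit (P t) := (hPε t ht).isUnit hε
  have hF : ContinuousOn (fun t => A t - riccatiGain C D P t * C t) (Ici 0) :=
    h.continuousOn_state.sub (continuousOn_matrix_mul (continuousOn_matrix_mul
      (continuousOn_matrix_mul hP.continuousOn
        (continuousOn_matrix_transpose h.continuousOn_output)) hD.1) h.continuousOn_output)
  refine globallyExponentiallyStable_of_lyapunov hF (inv_pos.2 hb) (inv_pos.2 hε) (div_pos ha hb)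
    (fun t ht => (hPb t ht).inv hb ((hPε t ht).posSemidef hε.le) (hunit t ht))
    (fun t ht => (hPε t ht).inv hε) fun t₀ x ht₀ hx => ⟨_, fun t ht => ⟨hP.hasDerivWithinAt_lyapunov
      ht₀ ht (hsymm t (ht₀.trans ht)) (hunit t (ht₀.trans ht)) hx, ?_⟩⟩
  have ht0 := ht₀.trans ht
  set y := (P t)⁻¹ *ᵥ x t with hy
  have hyx : x t ⬝ᵥ y ≤ b * (y ⬝ᵥ y) := by
    have hle := (hPb t ht0).dotProduct_le y
    rwa [hy, mulVec_nonsing_inv_mulVec (hunit t ht0), ← hy, dotProduct_comm] at hle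
  have hrate : a / b * (x t ⬝ᵥ y) ≤ y ⬝ᵥ (S t *ᵥ y) :=
    calc a / b * (x t ⬝ᵥ y) ≤ a / b * (b * (y ⬝ᵥ y)) := by gcongr
      _ = a * (y ⬝ᵥ y) := by field_simp
      _ ≤ y ⬝ᵥ (S t *ᵥ y) := (hSa t ht0).1.le_dotProduct y
  have hDC := (posSemidef_iff_transpose_eq_and_dotProduct_nonneg.1 (hD.posSemidef ht0)).2
    (C t *ᵥ x t)
  linarith

/-- The conclusion of the Riccati observer theorem for the pair `(A, C)`: for all weights `S`, `D`
and every positive definite `P₀` the Riccati equation has exactly one solution on `[0, ∞)`, and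
its gain makes the error system exponentially stable. -/
def HasStableRiccatiObserver [DecidableEq m] (A : ℝ → Matrix n n ℝ) (C : ℝ → Matrix m n ℝ) :
    Prop :=
  ∀ (S : ℝ → Matrix n n ℝ) (D : ℝ → Matrix m m ℝ) (P₀ : Matrix n n ℝ),
    IsWeight S → IsWeight D → P₀.PosDef →
    (∃ P, IsRiccatiSolution A C D S P ∧ P 0 = P₀) ∧
    (∀ P P', IsRiccatiSolution A C D S P → P 0 = P₀ →
      IsRiccatiSolution A C D S P' → P' 0 = P₀ → EqOn P P' (Ici 0)) ∧
    ∀ P, IsRiccatiSolution A C D S P → P 0 = P₀ →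
      GloballyExponentiallyStable fun t => A t - riccatiGain C D P t * C t

theorem UniformlyObservable.hasStableRiccatiObserver [DecidableEq m]
    (hobs : UniformlyObservable A C) (h : IsBoundedPair A C M) : HasStableRiccatiObserver A C := by
  intro S D P₀ hS hD hP₀
  have hA := h.continuousOn_state
  have hC := h.continuousOn_output
  exact ⟨exists_isRiccatiSolution hA hC hD.1 hS.1 (fun _ => hD.posSemidef)
      (fun _ => hS.posSemidef) hP₀,
    fun P P' hP h0 hP' h0' => hP.eqOn hA hC hD.1 hP' (h0.trans h0'.symm),
    fun P hP h0 => hP.globallyExponentiallyStable h hobs hD hS (h0 ▸ hP₀)⟩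

end Stability

/-! ### The observability Gramian as an integral of squared outputs -/

section Gramian

lemma dotProduct_matIntegral_mulVec {m n : Type*} [Fintype m] [Fintype n] {F : ℝ → Matrix m n ℝ}
    {a b : ℝ} (hab : a ≤ b) (hF : ContinuousOn F (Icc a b)) (x : m → ℝ) (y : n → ℝ) :
    x ⬝ᵥ (matIntegral F a b *ᵥ y) = ∫ s in a..b, x ⬝ᵥ (F s *ᵥ y) := by
  have hint (i : m) (j : n) :
      IntervalIntegrable (fun s => x i * (F s i j * y j)) MeasureTheory.volume a b :=
    ContinuousOn.intervalIntegrable_of_Icc hab (continuousOn_const.mul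
      ((continuousOn_pi.1 (continuousOn_pi.1 hF i) j).mul continuousOn_const))
  simp only [dotProduct, mulVec, Finset.mul_sum]
  rw [intervalIntegral.integral_finsetSum fun i _ => by
    simpa only [Finset.sum_fn] using IntervalIntegrable.sum Finset.univ fun j _ => hint i j]
  refine Finset.sum_congr rfl fun i _ => ?_
  rw [intervalIntegral.integral_finsetSum fun j _ => hint i j]
  refine Finset.sum_congr rfl fun j _ => ?_
  rw [intervalIntegral.integral_const_mul, intervalIntegral.integral_mul_const]
  rfl

lemma matIntegral_transpose {m n : Type*} (F : ℝ → Matrix m n ℝ) (a b : ℝ) :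
    (matIntegral F a b)ᵀ = matIntegral (fun s => (F s)ᵀ) a b := rfl

variable {m n : Type*} [Fintype m] [Fintype n] [DecidableEq n] {A : ℝ → Matrix n n ℝ}
  {C : ℝ → Matrix m n ℝ} {Φ : ℝ → ℝ → Matrix n n ℝ} {t δ : ℝ}

lemma dotProduct_gramian_mulVec (hΦ : IsTransitionMatrix A Φ) (hC : ContinuousOn C (Ici 0))
    (ht : 0 ≤ t) (hδ : 0 < δ) (x : n → ℝ) :
    x ⬝ᵥ (gramian Φ C t δ *ᵥ x) =
      1 / δ * ∫ s in t..t + δ, (C s *ᵥ Φ s t *ᵥ x) ⬝ᵥ (C s *ᵥ Φ s t *ᵥ x) := by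
  have hΦc : ContinuousOn (fun s => Φ s t) (Ici 0) := MatHasDerivWithinAt.continuousOn (hΦ t ht).2
  have hcont : ContinuousOn (fun s => (Φ s t)ᵀ * (C s)ᵀ * C s * Φ s t) (Icc t (t + δ)) :=
    (continuousOn_matrix_mul (continuousOn_matrix_mul (continuousOn_matrix_mul
      (continuousOn_matrix_transpose hΦc) (continuousOn_matrix_transpose hC)) hC) hΦc).mono
      fun s hs => ht.trans hs.1
  rw [gramian, smul_mulVec, dotProduct_smul, smul_eq_mul,
    dotProduct_matIntegral_mulVec (by linarith) hcont]
  simp only [← mulVec_mulVec, dotProduct_transpose_mulVec, dotProduct_comm _ (Φ _ _ *ᵥ _)]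

lemma loewnerGE_gramian_iff (hΦ : IsTransitionMatrix A Φ) (hC : ContinuousOn C (Ici 0))
    (ht : 0 ≤ t) (hδ : 0 < δ) {μ : ℝ} :
    LoewnerGE (gramian Φ C t δ) μ ↔ ∀ x, μ * (x ⬝ᵥ x) ≤
      1 / δ * ∫ s in t..t + δ, (C s *ᵥ Φ s t *ᵥ x) ⬝ᵥ (C s *ᵥ Φ s t *ᵥ x) := by
  have hsymm : (gramian Φ C t δ)ᵀ = gramian Φ C t δ := by
    rw [gramian, transpose_smul, matIntegral_transpose]
    simp only [transpose_mul, transpose_transpose, Matrix.mul_assoc]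
  simp only [loewnerGE_iff, hsymm, true_and, dotProduct_gramian_mulVec hΦ hC ht hδ]

end Gramian

/-! ### Orthogonal changes of coordinates -/

section OrthogonalChange

variable {m n : Type*} [Fintype m] [Fintype n] [DecidableEq n] {A A' R S P : ℝ → Matrix n n ℝ}
  {C C' : ℝ → Matrix m n ℝ} {D : ℝ → Matrix m m ℝ}

/-- `R` is an orthogonal change of coordinates on `[0, ∞)` taking `ẋ = A x` to `ẋ' = A' x'`
through `x' = R x`. -/
structure IsOrthogonalChange (R A A' : ℝ → Matrix n n ℝ) : Prop where
  transpose_mul_self : ∀ t, 0 ≤ t → (R t)ᵀ * R t = 1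
  deriv : ∀ t, 0 ≤ t → MatHasDerivWithinAt R (A' t * R t - R t * A t) (Ici 0) t

namespace IsOrthogonalChange

lemma mul_transpose_self (h : IsOrthogonalChange R A A') {t : ℝ} (ht : 0 ≤ t) :
    R t * (R t)ᵀ = 1 :=
  mul_eq_one_comm.1 (h.transpose_mul_self t ht)

lemma continuousOn (h : IsOrthogonalChange R A A') : ContinuousOn R (Ici 0) :=
  MatHasDerivWithinAt.continuousOn h.deriv

lemma symm (h : IsOrthogonalChange R A A') : IsOrthogonalChange (fun t => (R t)ᵀ) A' A where
  transpose_mul_self t ht := by rw [transpose_transpose, h.mul_transpose_self ht]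
  deriv t ht := by
    have hinv : EqOn (fun t => (R t)ᵀ) (fun t => (R t)⁻¹) (Ici 0) := fun t ht =>
      (inv_eq_left_inv (h.transpose_mul_self t ht)).symm
    have hunit : IsUnit (R t) := .of_mul_eq_one _ (h.mul_transpose_self ht)
    convert ((h.deriv t ht).inv hunit).congr hinv ht using 1
    have hcancel (M : Matrix n n ℝ) : (R t)ᵀ * (R t * M) = M := by
      rw [← Matrix.mul_assoc, h.transpose_mul_self t ht, Matrix.one_mul]
    rw [← show (R t)ᵀ = (R t)⁻¹ from hinv ht]
    simp only [Matrix.mul_sub, Matrix.sub_mul, Matrix.mul_assoc, hcancel,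
      h.mul_transpose_self ht, Matrix.mul_one, neg_sub]

lemma dotProduct_mulVec_self (h : IsOrthogonalChange R A A') {t : ℝ} (ht : 0 ≤ t) (x : n → ℝ) :
    (R t *ᵥ x) ⬝ᵥ (R t *ᵥ x) = x ⬝ᵥ x := by
  rw [← dotProduct_transpose_mulVec, mulVec_mulVec, h.transpose_mul_self t ht, one_mulVec]

lemma euclNorm_mulVec (h : IsOrthogonalChange R A A') {t : ℝ} (ht : 0 ≤ t) (x : n → ℝ) :
    euclNorm (R t *ᵥ x) = euclNorm x := by
  rw [euclNorm_eq_sqrt, euclNorm_eq_sqrt, h.dotProduct_mulVec_self ht]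

lemma isLinearSolution (h : IsOrthogonalChange R A A') {t₀ : ℝ} (ht₀ : 0 ≤ t₀) {x : ℝ → n → ℝ}
    (hx : IsLinearSolution A t₀ x) : IsLinearSolution A' t₀ fun t => R t *ᵥ x t := by
  intro t ht
  refine (((h.deriv t (ht₀.trans ht)).mono (Ici_subset_Ici.2 ht₀)).mulVec (hx t ht)).congr_deriv ?_
  rw [sub_mulVec, ← mulVec_mulVec, ← mulVec_mulVec, sub_add_cancel]

lemma globallyExponentiallyStable (h : IsOrthogonalChange R A A')
    (hA' : GloballyExponentiallyStable A') : GloballyExponentiallyStable A := by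
  obtain ⟨c, l, hc, hl, hA'⟩ := hA'
  refine ⟨c, l, hc, hl, fun t₀ ht₀ x₀ => ⟨?_, fun x hx hx₀ t ht => ?_⟩⟩
  · obtain ⟨x', hx', hx₀'⟩ := (hA' t₀ ht₀ (R t₀ *ᵥ x₀)).1
    refine ⟨_, h.symm.isLinearSolution ht₀ hx', ?_⟩
    simp only [hx₀', mulVec_mulVec, h.transpose_mul_self t₀ ht₀, one_mulVec]
  · have hdecay := (hA' t₀ ht₀ (R t₀ *ᵥ x₀)).2 _ (h.isLinearSolution ht₀ hx) (by rw [hx₀]) t ht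
    rwa [h.euclNorm_mulVec (ht₀.trans ht), h.euclNorm_mulVec ht₀] at hdecay

lemma transpose_mul_conj_mul (h : IsOrthogonalChange R A A') {t : ℝ} (ht : 0 ≤ t)
    (M : Matrix n n ℝ) : (R t)ᵀ * (R t * M * (R t)ᵀ) * R t = M := by
  rw [Matrix.mul_assoc, Matrix.mul_assoc, h.transpose_mul_self t ht, Matrix.mul_one,
    ← Matrix.mul_assoc, h.transpose_mul_self t ht, Matrix.one_mul]

lemma isRiccatiSolution (h : IsOrthogonalChange R A A')
    (hC : ∀ t, 0 ≤ t → C t = C' t * R t) (hP : IsRiccatiSolution A C D S P) :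
    IsRiccatiSolution A' C' D (fun t => R t * S t * (R t)ᵀ) fun t => R t * P t * (R t)ᵀ := by
  intro t ht
  convert ((h.deriv t ht).mul (hP t ht)).mul (h.deriv t ht).transpose using 1
  simp only [hC t ht, transpose_mul, transpose_sub, Matrix.mul_add, Matrix.add_mul,
    Matrix.mul_sub, Matrix.sub_mul, Matrix.mul_assoc]
  abel

lemma isWeight (h : IsOrthogonalChange R A A') (hS : IsWeight S) :
    IsWeight fun t => R t * S t * (R t)ᵀ := by
  obtain ⟨hcont, a, b, ha, hab⟩ := hS
  have hconj (t : ℝ) (ht : 0 ≤ t) (c : ℝ) :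
      R t * (c • (1 : Matrix n n ℝ)) * (R t)ᵀ = c • 1 := by
    rw [Matrix.mul_smul, Matrix.smul_mul, Matrix.mul_one, h.mul_transpose_self ht]
  refine ⟨continuousOn_matrix_mul (continuousOn_matrix_mul h.continuousOn hcont)
    (continuousOn_matrix_transpose h.continuousOn), a, b, ha, fun t ht => ⟨?_, ?_⟩⟩
  · have hle := (hab t ht).1.mul_mul_conjTranspose_same (R t)
    rwa [conjTranspose_eq_transpose_of_trivial, Matrix.mul_sub, Matrix.sub_mul,
      hconj t ht] at hle
  · have hle := (hab t ht).2.mul_mul_conjTranspose_same (R t)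
    rwa [conjTranspose_eq_transpose_of_trivial, Matrix.mul_sub, Matrix.sub_mul,
      hconj t ht] at hle

lemma closedLoop (h : IsOrthogonalChange R A A') (hC : ∀ t, 0 ≤ t → C t = C' t * R t) :
    IsOrthogonalChange R (fun t => A t - riccatiGain C D P t * C t) fun t =>
      A' t - riccatiGain C' D (fun t => R t * P t * (R t)ᵀ) t * C' t where
  transpose_mul_self := h.transpose_mul_self
  deriv t ht := by
    convert h.deriv t ht using 1
    simp only [riccatiGain, hC t ht, transpose_mul, Matrix.sub_mul, Matrix.mul_sub,
      Matrix.mul_assoc]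
    abel

theorem hasStableRiccatiObserver [DecidableEq m] (h : IsOrthogonalChange R A A')
    (hC : ∀ t, 0 ≤ t → C t = C' t * R t) (hobs : HasStableRiccatiObserver A' C') :
    HasStableRiccatiObserver A C := by
  intro S D P₀ hS hD hP₀
  have hC' (t : ℝ) (ht : 0 ≤ t) : C' t = C t * (R t)ᵀ := by
    rw [hC t ht, Matrix.mul_assoc, h.mul_transpose_self ht, Matrix.mul_one]
  have hP₀' : (R 0 * P₀ * (R 0)ᵀ).PosDef := by
    have hunit : IsUnit (R 0) := .of_mul_eq_one _ (h.mul_transpose_self le_rfl)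
    exact (IsUnit.posDef_star_right_conjugate_iff hunit).2 hP₀
  obtain ⟨⟨P', hP', hP'0⟩, huniq, hstable⟩ := hobs _ D _ (h.isWeight hS) hD hP₀'
  refine ⟨⟨fun t => (R t)ᵀ * P' t * R t, fun t ht => ?_, ?_⟩, fun P₁ P₂ hP₁ h₁ hP₂ h₂ t ht => ?_,
    fun P hP h0 => ?_⟩
  · have hP := h.symm.isRiccatiSolution hC' hP' t ht
    simpa only [transpose_transpose, h.transpose_mul_conj_mul ht] using hP
  · simp only [hP'0, h.transpose_mul_conj_mul le_rfl]
  · have heq := huniq _ _ (h.isRiccatiSolution hC hP₁) (by rw [h₁]) (h.isRiccatiSolution hC hP₂)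
      (by rw [h₂]) ht
    rw [← h.transpose_mul_conj_mul ht (P₁ t), ← h.transpose_mul_conj_mul ht (P₂ t)]
    exact congrArg (fun M => (R t)ᵀ * M * R t) heq
  · exact (h.closedLoop hC).globallyExponentiallyStable
      (hstable _ (h.isRiccatiSolution hC hP) (by rw [h0]))

lemma isTransitionMatrix (h : IsOrthogonalChange R A A') {Φ : ℝ → ℝ → Matrix n n ℝ}
    (hΦ : IsTransitionMatrix A Φ) :
    IsTransitionMatrix A' fun s t => R s * Φ s t * (R t)ᵀ := by
  refine fun t ht => ⟨?_, fun s hs => ?_⟩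
  · simp only [(hΦ t ht).1, Matrix.mul_one, h.mul_transpose_self ht]
  · convert ((h.deriv s hs).mul ((hΦ t ht).2 s hs)).mul (.const (R t)ᵀ) using 1
    simp only [Matrix.mul_zero, add_zero, Matrix.sub_mul, Matrix.mul_assoc, sub_add_cancel]

theorem uniformlyObservable (h : IsOrthogonalChange R A A') (hC : ∀ t, 0 ≤ t → C t = C' t * R t)
    (hcont : ContinuousOn C' (Ici 0)) (hobs : UniformlyObservable A' C') :
    UniformlyObservable A C := by
  obtain ⟨Φ, hΦ, δ, μ, hδ, hμ, hgram⟩ := hobs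
  have hcontC : ContinuousOn C (Ici 0) :=
    (continuousOn_matrix_mul hcont h.continuousOn).congr fun t ht => hC t ht
  refine ⟨_, h.symm.isTransitionMatrix hΦ, δ, μ, hδ, hμ, fun t ht => ?_⟩
  rw [loewnerGE_gramian_iff (h.symm.isTransitionMatrix hΦ) hcontC ht hδ]
  intro x
  have hle := (loewnerGE_gramian_iff hΦ hcont ht hδ).1 (hgram t ht) (R t *ᵥ x)
  rw [h.dotProduct_mulVec_self ht] at hle
  refine hle.trans_eq (congrArg _ (intervalIntegral.integral_congr fun s hs => ?_))
  rw [uIcc_of_le (by linarith)] at hs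
  have hs0 : 0 ≤ s := ht.trans hs.1
  simp only [hC s hs0, mulVec_mulVec, Matrix.mul_assoc, transpose_transpose]
  rw [← Matrix.mul_assoc (R s), h.mul_transpose_self hs0, Matrix.one_mul]

end IsOrthogonalChange

end OrthogonalChange

/-! ### The double integrator with a persistently exciting output -/

section DoubleIntegrator

lemma continuousOn_fromCols_zero {m n : Type*} {M : ℝ → Matrix m n ℝ}
    (hM : ContinuousOn M (Ici 0)) :
    ContinuousOn (fun t => fromCols (M t) (0 : Matrix m n ℝ)) (Ici 0) := by
  refine continuousOn_pi.2 fun i => continuousOn_pi.2 ?_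
  rintro (j | _)
  · exact continuousOn_pi.1 (continuousOn_pi.1 hM i) j
  · exact continuousOn_const

variable {m n : Type*} [Fintype m] [Fintype n] {M : ℝ → Matrix m n ℝ} {δ μ N t : ℝ}

lemma half_dotProduct_self_sub_le (x y : n → ℝ) :
    1 / 2 * (x ⬝ᵥ x) - y ⬝ᵥ y ≤ (x + y) ⬝ᵥ (x + y) := by
  have hsq := dotProduct_self_nonneg_real (x + (2 : ℝ) • y)
  simp only [add_dotProduct, dotProduct_add, smul_dotProduct, dotProduct_smul, smul_eq_mul,
    dotProduct_comm y x] at hsq ⊢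
  linarith

lemma intervalIntegrable_affine_output (hM : ContinuousOn M (Ici 0)) {a b : ℝ} (ha : 0 ≤ a)
    (hab : a ≤ b) (t : ℝ) (v w : n → ℝ) :
    IntervalIntegrable (fun s => (M s *ᵥ (v + (s - t) • w)) ⬝ᵥ (M s *ᵥ (v + (s - t) • w)))
      MeasureTheory.volume a b := by
  have hline : ContinuousOn (fun s : ℝ => v + (s - t) • w) (Ici 0) := by fun_prop
  have hout := continuousOn_pi.1 (continuousOn_matrix_mulVec hM hline)
  refine ContinuousOn.intervalIntegrable_of_Icc hab ?_
  exact (continuousOn_finsetSum _ fun i _ => (hout i).mul (hout i)).mono fun s hs => ha.trans hs.1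

lemma le_integral_affine_output (hM : ContinuousOn M (Ici 0))
    (hN : ∀ t, 0 ≤ t → ∀ x, (M t *ᵥ x) ⬝ᵥ (M t *ᵥ x) ≤ N * (x ⬝ᵥ x)) (hδ : 0 ≤ δ)
    (ht : 0 ≤ t) {v : n → ℝ}
    (hv : μ * (v ⬝ᵥ v) ≤ ∫ s in t..t + δ, (M s *ᵥ v) ⬝ᵥ (M s *ᵥ v)) (w : n → ℝ) :
    1 / 2 * (μ * (v ⬝ᵥ v)) - δ ^ 3 * N * (w ⬝ᵥ w) ≤
      ∫ s in t..t + δ, (M s *ᵥ (v + (s - t) • w)) ⬝ᵥ (M s *ᵥ (v + (s - t) • w)) := by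
  have hle : t ≤ t + δ := by linarith
  have hint : IntervalIntegrable (fun s => (M s *ᵥ v) ⬝ᵥ (M s *ᵥ v)) MeasureTheory.volume t
      (t + δ) := by
    simpa only [smul_zero, add_zero] using intervalIntegrable_affine_output hM ht hle t v 0
  calc 1 / 2 * (μ * (v ⬝ᵥ v)) - δ ^ 3 * N * (w ⬝ᵥ w)
      ≤ 1 / 2 * (∫ s in t..t + δ, (M s *ᵥ v) ⬝ᵥ (M s *ᵥ v)) - δ * (δ ^ 2 * (N * (w ⬝ᵥ w))) := by
        linarith
    _ = ∫ s in t..t + δ, (1 / 2 * ((M s *ᵥ v) ⬝ᵥ (M s *ᵥ v)) - δ ^ 2 * (N * (w ⬝ᵥ w))) := by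
        rw [intervalIntegral.integral_sub (hint.const_mul _) intervalIntegrable_const,
          intervalIntegral.integral_const_mul, intervalIntegral.integral_const,
          add_sub_cancel_left, smul_eq_mul]
    _ ≤ _ := by
        refine intervalIntegral.integral_mono_on hle
          ((hint.const_mul _).sub intervalIntegrable_const)
          (intervalIntegrable_affine_output hM ht hle t v w) fun s hs => ?_
        have hsplit := half_dotProduct_self_sub_le (M s *ᵥ v) ((s - t) • (M s *ᵥ w))
        have hst : (s - t) ^ 2 ≤ δ ^ 2 :=
          pow_le_pow_left₀ (by linarith [hs.1]) (by linarith [hs.2]) 2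
        have hw : (s - t) ^ 2 * ((M s *ᵥ w) ⬝ᵥ (M s *ᵥ w)) ≤ δ ^ 2 * (N * (w ⬝ᵥ w)) :=
          mul_le_mul hst (hN s (ht.trans hs.1) w) (dotProduct_self_nonneg_real _) (sq_nonneg δ)
        rw [mulVec_add, mulVec_smul]
        simp only [smul_dotProduct, dotProduct_smul, smul_eq_mul] at hsplit
        linarith

theorem exists_le_integral_affine_output (hM : ContinuousOn M (Ici 0))
    (hN : ∀ t, 0 ≤ t → ∀ x, (M t *ᵥ x) ⬝ᵥ (M t *ᵥ x) ≤ N * (x ⬝ᵥ x)) (hN₀ : 0 ≤ N)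
    (hδ : 0 < δ) (hμ : 0 < μ) (hpe : ∀ t, 0 ≤ t → ∀ v,
      μ * (v ⬝ᵥ v) ≤ ∫ s in t..t + δ, (M s *ᵥ v) ⬝ᵥ (M s *ᵥ v)) :
    ∃ δ' μ' : ℝ, 0 < δ' ∧ 0 < μ' ∧ ∀ t, 0 ≤ t → ∀ v w, μ' * (v ⬝ᵥ v + w ⬝ᵥ w) ≤
      ∫ s in t..t + δ', (M s *ᵥ (v + (s - t) • w)) ⬝ᵥ (M s *ᵥ (v + (s - t) • w)) := by
  -- The windows of length `δ` at `t` and at `t + h` see the positions `v` and `v + h w`; with this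
  -- `h`, two thirds of the first bound plus one third of the second is the claim.
  set h := √(12 * (δ ^ 3 * N) / μ + 2)
  have hh : 0 ≤ h := Real.sqrt_nonneg _
  have hsq : h ^ 2 = 12 * (δ ^ 3 * N) / μ + 2 := Real.sq_sqrt (by positivity)
  refine ⟨h + δ, μ / 6, by positivity, by positivity, fun t ht v w => ?_⟩
  set J := ∫ s in t..t + (h + δ), (M s *ᵥ (v + (s - t) • w)) ⬝ᵥ (M s *ᵥ (v + (s - t) • w))
  have hwindow (r : ℝ) (hr : 0 ≤ r) (hrh : r ≤ h) :
      1 / 2 * (μ * ((v + r • w) ⬝ᵥ (v + r • w))) - δ ^ 3 * N * (w ⬝ᵥ w) ≤ J := by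
    have htr : 0 ≤ t + r := add_nonneg ht hr
    calc _ ≤ ∫ s in t + r..t + r + δ, (M s *ᵥ (v + r • w + (s - (t + r)) • w)) ⬝ᵥ
            (M s *ᵥ (v + r • w + (s - (t + r)) • w)) :=
          le_integral_affine_output hM hN hδ.le htr (hpe _ htr _) w
      _ = ∫ s in t + r..t + r + δ, (M s *ᵥ (v + (s - t) • w)) ⬝ᵥ (M s *ᵥ (v + (s - t) • w)) := by
          simp only [add_assoc v, ← add_smul, add_sub_left_comm, sub_add_eq_sub_sub,
            sub_self, add_zero]
      _ ≤ J := intervalIntegral.integral_mono_interval (by linarith) (by linarith) (by linarith)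
          ((MeasureTheory.ae_restrict_mem measurableSet_Ioc).mono fun _ _ =>
            dotProduct_self_nonneg_real _)
          (intervalIntegrable_affine_output hM ht (by linarith) t v w)
  have hfirst := hwindow 0 le_rfl hh
  have hsecond := hwindow h hh le_rfl
  have hsplit := mul_le_mul_of_nonneg_left (half_dotProduct_self_sub_le (h • w) v) hμ.le
  have hscale : μ * (h ^ 2 * (w ⬝ᵥ w)) =
      12 * (δ ^ 3 * N * (w ⬝ᵥ w)) + 2 * (μ * (w ⬝ᵥ w)) := by
    rw [hsq]
    field_simp
  rw [zero_smul, add_zero] at hfirst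
  rw [add_comm (h • w) v] at hsplit
  simp only [smul_dotProduct, dotProduct_smul, smul_eq_mul] at hsplit
  linarith

lemma dotProduct_self_sum (x : m ⊕ n → ℝ) :
    x ⬝ᵥ x = (x ∘ Sum.inl) ⬝ᵥ (x ∘ Sum.inl) + (x ∘ Sum.inr) ⬝ᵥ (x ∘ Sum.inr) := by
  simp [dotProduct]

variable [DecidableEq n]

/-- The state matrix of `p̈ = 0` in the coordinates `(p, ṗ)`. -/
def doubleIntegrator (n : Type*) [DecidableEq n] : Matrix (n ⊕ n) (n ⊕ n) ℝ :=
  fromBlocks 0 1 0 0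

/-- The transition matrix over a time `r` of the double integrator. -/
def doubleIntegratorFlow (n : Type*) [DecidableEq n] (r : ℝ) : Matrix (n ⊕ n) (n ⊕ n) ℝ :=
  fromBlocks 1 (r • 1) 0 1

lemma doubleIntegratorFlow_mulVec (r : ℝ) (x : n ⊕ n → ℝ) :
    doubleIntegratorFlow n r *ᵥ x =
      Sum.elim (x ∘ Sum.inl + r • (x ∘ Sum.inr)) (x ∘ Sum.inr) := by
  simp [doubleIntegratorFlow, fromBlocks_mulVec, smul_mulVec]

lemma isTransitionMatrix_doubleIntegrator :
    IsTransitionMatrix (fun _ => doubleIntegrator n) fun s t => doubleIntegratorFlow n (s - t) := by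
  refine fun t _ => ⟨by simp [doubleIntegratorFlow], fun s _ => ?_⟩
  simp only [doubleIntegrator, doubleIntegratorFlow, fromBlocks_multiply]
  rintro (i | i) (j | j)
  · simpa using hasDerivWithinAt_const s (Ici 0) ((1 : Matrix n n ℝ) i j)
  · simpa using (((hasDerivWithinAt_id s (Ici 0)).sub_const t).mul_const ((1 : Matrix n n ℝ) i j))
  · simpa using hasDerivWithinAt_const s (Ici 0) (0 : ℝ)
  · simpa using hasDerivWithinAt_const s (Ici 0) ((1 : Matrix n n ℝ) i j)

theorem uniformlyObservable_doubleIntegrator (hM : ContinuousOn M (Ici 0))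
    (hN : ∀ t, 0 ≤ t → ∀ x, (M t *ᵥ x) ⬝ᵥ (M t *ᵥ x) ≤ N * (x ⬝ᵥ x)) (hN₀ : 0 ≤ N)
    (hδ : 0 < δ) (hμ : 0 < μ) (hpe : ∀ t, 0 ≤ t → ∀ v,
      μ * (v ⬝ᵥ v) ≤ ∫ s in t..t + δ, (M s *ᵥ v) ⬝ᵥ (M s *ᵥ v)) :
    UniformlyObservable (fun _ => doubleIntegrator n) fun t => fromCols (M t) 0 := by
  obtain ⟨δ', μ', hδ', hμ', hle⟩ := exists_le_integral_affine_output hM hN hN₀ hδ hμ hpe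
  refine ⟨_, isTransitionMatrix_doubleIntegrator, δ', 1 / δ' * μ', hδ', by positivity,
    fun t ht => (loewnerGE_gramian_iff isTransitionMatrix_doubleIntegrator
      (continuousOn_fromCols_zero hM) ht hδ').2 fun x => ?_⟩
  simp only [doubleIntegratorFlow_mulVec, fromCols_mulVec, Sum.elim_comp_inl, zero_mulVec,
    add_zero, dotProduct_self_sum x, mul_assoc]
  exact mul_le_mul_of_nonneg_left (hle t ht _ _) (by positivity)

lemma isBoundedPair_doubleIntegrator (hM : ContinuousOn M (Ici 0))
    (hN : ∀ t, 0 ≤ t → ∀ x, (M t *ᵥ x) ⬝ᵥ (M t *ᵥ x) ≤ N * (x ⬝ᵥ x)) :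
    IsBoundedPair (fun _ => doubleIntegrator n) (fun t => fromCols (M t) 0) (max 1 N) where
  nonneg := by positivity
  continuousOn_state := continuousOn_const
  continuousOn_output := continuousOn_fromCols_zero hM
  abs_dotProduct_le t _ x := by
    have heq : x ⬝ᵥ (doubleIntegrator n *ᵥ x) = (x ∘ Sum.inl) ⬝ᵥ (x ∘ Sum.inr) := by
      rw [doubleIntegrator, fromBlocks_mulVec]
      simp [dotProduct]
    have hle := two_mul_dotProduct_le one_pos (x ∘ Sum.inl) (x ∘ Sum.inr)
    have hge := two_mul_dotProduct_le one_pos (x ∘ Sum.inl) (-(x ∘ Sum.inr))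
    rw [neg_dotProduct_neg, dotProduct_neg] at hge
    have hmax := mul_le_mul_of_nonneg_right (le_max_left 1 N) (dotProduct_self_nonneg_real x)
    rw [heq, abs_le]
    rw [inv_one, ← mul_add, ← dotProduct_self_sum x] at hle hge
    constructor <;> linarith [dotProduct_self_nonneg_real x]
  output_le t ht x := by
    rw [fromCols_mulVec, zero_mulVec, add_zero]
    calc _ ≤ N * ((x ∘ Sum.inl) ⬝ᵥ (x ∘ Sum.inl)) := hN t ht _
      _ ≤ max 1 N * (x ⬝ᵥ x) := by
          gcongr
          · exact dotProduct_self_nonneg_real _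
          · exact le_max_right 1 N
          · rw [dotProduct_self_sum x]
            exact le_add_of_nonneg_right (dotProduct_self_nonneg_real _)

end DoubleIntegrator

/-! ### The position and velocity error system -/

section ErrorSystem

lemma proj_mulVec (u v : Fin 3 → ℝ) : proj u *ᵥ v = v - (u ⬝ᵥ v) • u := by
  rw [proj, sub_mulVec, one_mulVec, vecMulVec_mulVec]
  simp

lemma dotProduct_proj_mulVec (u v : Fin 3 → ℝ) :
    v ⬝ᵥ (proj u *ᵥ v) = v ⬝ᵥ v - (u ⬝ᵥ v) ^ 2 := by
  rw [proj_mulVec, dotProduct_sub, dotProduct_smul, smul_eq_mul, dotProduct_comm v u, sq]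

lemma proj_mulVec_dotProduct_self {u : Fin 3 → ℝ} (hu : u ⬝ᵥ u = 1) (v : Fin 3 → ℝ) :
    (proj u *ᵥ v) ⬝ᵥ (proj u *ᵥ v) = v ⬝ᵥ v - (u ⬝ᵥ v) ^ 2 := by
  simp only [proj_mulVec, sub_dotProduct, dotProduct_sub, smul_dotProduct, dotProduct_smul,
    smul_eq_mul, hu, dotProduct_comm v u]
  ring

lemma continuousOn_proj {y : ℝ → Fin 3 → ℝ} {s : Set ℝ} (hy : ContinuousOn y s) :
    ContinuousOn (fun t => proj (y t)) s := by
  rw [continuousOn_iff_continuous_domRestrict] at *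
  exact continuous_const.sub (Continuous.matrix_vecMulVec hy hy)

lemma euclNorm_ne_zero {n : Type*} [Fintype n] {x : n → ℝ} (hx : x ≠ 0) : euclNorm x ≠ 0 :=
  norm_ne_zero_iff.2 (mt (WithLp.toLp_eq_zero 2).1 hx)

variable {g : ℝ} {B T : RigidMotion g}

namespace RigidMotion

lemma transpose_mul_self (B : RigidMotion g) {t : ℝ} (ht : 0 ≤ t) : (B.Q t)ᵀ * B.Q t = 1 :=
  (mem_orthogonalGroup_iff' (Fin 3) ℝ).1 (mem_specialOrthogonalGroup_iff.1 (B.Q_mem t ht)).1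

lemma mul_transpose_self (B : RigidMotion g) {t : ℝ} (ht : 0 ≤ t) : B.Q t * (B.Q t)ᵀ = 1 :=
  mul_eq_one_comm.1 (B.transpose_mul_self ht)

lemma dotProduct_transpose_mulVec_self (B : RigidMotion g) {t : ℝ} (ht : 0 ≤ t) (x : Fin 3 → ℝ) :
    ((B.Q t)ᵀ *ᵥ x) ⬝ᵥ ((B.Q t)ᵀ *ᵥ x) = x ⬝ᵥ x := by
  rw [dotProduct_transpose_mulVec, mulVec_mulVec, B.mul_transpose_self ht, one_mulVec]

lemma continuousOn_Q (B : RigidMotion g) : ContinuousOn B.Q (Ici 0) :=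
  MatHasDerivWithinAt.continuousOn B.Q_deriv

lemma continuousOn_p (B : RigidMotion g) : ContinuousOn B.p (Ici 0) :=
  fun t ht => (B.p_deriv t ht).continuousWithinAt

end RigidMotion

lemma continuousOn_relPos (B T : RigidMotion g) : ContinuousOn (relPos B T) (Ici 0) :=
  continuousOn_matrix_mulVec (continuousOn_matrix_transpose B.continuousOn_Q)
    (B.continuousOn_p.sub T.continuousOn_p)

lemma continuousOn_bearing (hξ : ∀ t, 0 ≤ t → relPos B T t ≠ 0) :
    ContinuousOn (bearing B T) (Ici 0) := by
  have hnorm : ContinuousOn (fun t => euclNorm (relPos B T t)) (Ici 0) :=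
    ((PiLp.continuous_toLp 2 _).comp_continuousOn (continuousOn_relPos B T)).norm
  exact (hnorm.inv₀ fun t ht => euclNorm_ne_zero (hξ t ht)).smul (continuousOn_relPos B T)

lemma bearing_dotProduct_self {t : ℝ} (hξ : relPos B T t ≠ 0) :
    bearing B T t ⬝ᵥ bearing B T t = 1 := by
  have hnorm := euclNorm_ne_zero hξ
  rw [bearing, smul_dotProduct, dotProduct_smul, dotProduct_self_eq_euclNorm_sq, smul_eq_mul,
    smul_eq_mul]
  field_simp

/-- The change of coordinates from the body frame to the inertial frame, acting on position and
velocity errors alike. -/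
noncomputable def bodyToInertial (B : RigidMotion g) (t : ℝ) :
    Matrix (Fin 3 ⊕ Fin 3) (Fin 3 ⊕ Fin 3) ℝ :=
  fromBlocks (B.Q t) 0 0 (B.Q t)

/-- The position block of the output matrix of the error system, in the inertial frame. -/
noncomputable def inertialOutput (B T : RigidMotion g) (t : ℝ) : Matrix (Fin 3) (Fin 3) ℝ :=
  proj (bearing B T t) * (B.Q t)ᵀ

lemma isOrthogonalChange_bodyToInertial (B : RigidMotion g) :
    IsOrthogonalChange (bodyToInertial B) (errorA B) fun _ => doubleIntegrator (Fin 3) where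
  transpose_mul_self t ht := by
    simp [bodyToInertial, fromBlocks_transpose, fromBlocks_multiply, B.transpose_mul_self ht]
  deriv t ht := by
    have hderiv : doubleIntegrator (Fin 3) * bodyToInertial B t - bodyToInertial B t * errorA B t =
        fromBlocks (B.Q t * skew (B.ω t)) 0 0 (B.Q t * skew (B.ω t)) := by
      simp [bodyToInertial, errorA, doubleIntegrator, fromBlocks_multiply, sub_eq_add_neg,
        fromBlocks_neg, fromBlocks_add]
    rw [hderiv]
    rintro (i | i) (j | j)
    · exact B.Q_deriv t ht i j
    · exact hasDerivWithinAt_const t (Ici 0) 0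
    · exact hasDerivWithinAt_const t (Ici 0) 0
    · exact B.Q_deriv t ht i j

lemma errorC_eq_mul_bodyToInertial {t : ℝ} (ht : 0 ≤ t) :
    errorC B T t = (fromCols (inertialOutput B T t) 0 : Matrix (Fin 3) (Fin 3 ⊕ Fin 3) ℝ) *
      bodyToInertial B t := by
  rw [inertialOutput, bodyToInertial, fromCols_mul_fromBlocks, Matrix.mul_assoc,
    B.transpose_mul_self ht]
  simp [errorC]

lemma continuousOn_inertialOutput (hξ : ∀ t, 0 ≤ t → relPos B T t ≠ 0) :
    ContinuousOn (inertialOutput B T) (Ici 0) :=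
  continuousOn_matrix_mul (continuousOn_proj (continuousOn_bearing hξ))
    (continuousOn_matrix_transpose B.continuousOn_Q)

lemma inertialOutput_mulVec_dotProduct_self {t : ℝ} (ht : 0 ≤ t) (hξ : relPos B T t ≠ 0)
    (v : Fin 3 → ℝ) : (inertialOutput B T t *ᵥ v) ⬝ᵥ (inertialOutput B T t *ᵥ v) =
      v ⬝ᵥ (proj (inertialBearing B T t) *ᵥ v) := by
  rw [inertialOutput, ← mulVec_mulVec, proj_mulVec_dotProduct_self (bearing_dotProduct_self hξ),
    dotProduct_proj_mulVec, B.dotProduct_transpose_mulVec_self ht, dotProduct_transpose_mulVec,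
    inertialBearing, dotProduct_comm v (B.Q t *ᵥ _)]

lemma inertialOutput_mulVec_dotProduct_self_le {t : ℝ} (ht : 0 ≤ t) (hξ : relPos B T t ≠ 0)
    (v : Fin 3 → ℝ) :
    (inertialOutput B T t *ᵥ v) ⬝ᵥ (inertialOutput B T t *ᵥ v) ≤ 1 * (v ⬝ᵥ v) := by
  rw [inertialOutput_mulVec_dotProduct_self ht hξ, dotProduct_proj_mulVec, one_mul]
  exact sub_le_self _ (sq_nonneg _)

lemma PersistentlyExciting.exists_le_integral_inertialOutput
    (hξ : ∀ t, 0 ≤ t → relPos B T t ≠ 0) (hPE : PersistentlyExciting (inertialBearing B T)) :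
    ∃ δ μ : ℝ, 0 < δ ∧ 0 < μ ∧ ∀ t, 0 ≤ t → ∀ v, μ * (v ⬝ᵥ v) ≤
      ∫ s in t..t + δ, (inertialOutput B T s *ᵥ v) ⬝ᵥ (inertialOutput B T s *ᵥ v) := by
  obtain ⟨δ, μ, hδ, hμ, hPE⟩ := hPE
  have hcont : ContinuousOn (fun s => proj (inertialBearing B T s)) (Ici 0) :=
    continuousOn_proj (continuousOn_matrix_mulVec B.continuousOn_Q (continuousOn_bearing hξ))
  refine ⟨δ, δ * μ, hδ, by positivity, fun t ht v => ?_⟩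
  have hle := (hPE t ht).le_dotProduct v
  rw [smul_mulVec, dotProduct_smul, smul_eq_mul, one_div, ← div_eq_inv_mul, le_div_iff₀' hδ,
    dotProduct_matIntegral_mulVec (by linarith) (hcont.mono fun s hs => ht.trans hs.1),
    ← mul_assoc] at hle
  refine hle.trans_eq (intervalIntegral.integral_congr fun s hs => ?_)
  rw [uIcc_of_le (by linarith)] at hs
  have hs0 : 0 ≤ s := ht.trans hs.1
  exact (inertialOutput_mulVec_dotProduct_self hs0 (hξ s hs0) v).symm

end ErrorSystem

theorem lemma2_general {g : ℝ} {B T : RigidMotion g} (hξ : ∀ t, 0 ≤ t → relPos B T t ≠ 0)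
    (hPE : PersistentlyExciting (inertialBearing B T)) :
    UniformlyObservable (errorA B) (errorC B T) ∧
      HasStableRiccatiObserver (errorA B) (errorC B T) := by
  have hframe := isOrthogonalChange_bodyToInertial B
  have houtput (t : ℝ) (ht : 0 ≤ t) := errorC_eq_mul_bodyToInertial (B := B) (T := T) ht
  have hcont := continuousOn_inertialOutput hξ
  have hle (t : ℝ) (ht : 0 ≤ t) := inertialOutput_mulVec_dotProduct_self_le ht (hξ t ht)
  obtain ⟨δ, μ, hδ, hμ, hexcite⟩ := hPE.exists_le_integral_inertialOutput hξ
  have hobs := uniformlyObservable_doubleIntegrator hcont hle zero_le_one hδ hμ hexcite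
  exact ⟨hframe.uniformlyObservable houtput (continuousOn_fromCols_zero hcont) hobs,
    hframe.hasStableRiccatiObserver houtput
      (hobs.hasStableRiccatiObserver (isBoundedPair_doubleIntegrator hcont hle))⟩

theorem lemma2 (g : ℝ) (B T : RigidMotion g)
    (hBuc : UniformContinuousOn B.ω (Set.Ici 0))
    (hTuc : UniformContinuousOn T.ω (Set.Ici 0))
    (hBbd : ∃ M : ℝ, ∀ t, 0 ≤ t → euclNorm (B.ω t) ≤ M)
    (hTbd : ∃ M : ℝ, ∀ t, 0 ≤ t → euclNorm (T.ω t) ≤ M)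
    (hξ : ∀ t, 0 ≤ t → relPos B T t ≠ 0)
    (hPE : PersistentlyExciting (inertialBearing B T)) :
    UniformlyObservable (errorA B) (errorC B T) ∧
    ∀ (S : ℝ → Matrix (Fin 3 ⊕ Fin 3) (Fin 3 ⊕ Fin 3) ℝ) (D : ℝ → Matrix (Fin 3) (Fin 3) ℝ)
      (P₀ : Matrix (Fin 3 ⊕ Fin 3) (Fin 3 ⊕ Fin 3) ℝ),
      IsWeight S → IsWeight D → P₀.PosDef →
      (∃ P, IsRiccatiSolution (errorA B) (errorC B T) D S P ∧ P 0 = P₀) ∧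
      (∀ P P', IsRiccatiSolution (errorA B) (errorC B T) D S P → P 0 = P₀ →
        IsRiccatiSolution (errorA B) (errorC B T) D S P' → P' 0 = P₀ →
        Set.EqOn P P' (Set.Ici 0)) ∧
      (∀ P, IsRiccatiSolution (errorA B) (errorC B T) D S P → P 0 = P₀ →
        GloballyExponentiallyStable
          (fun t => errorA B t - riccatiGain (errorC B T) D P t * errorC B T t)) :=
  lemma2_general hξ hPE
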